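/- **Setting.** Let $(S,\mathcal S,P)$ be a probability space, $Z\sim P$, $\ell:S\times\mathbb R^p\to\mathbb R$, $L(\theta)=\mathbf E[\ell(Z,\theta)]$, and let $Z_1,Z_2,\dots$ be i.i.d. with law $P$, $\mathcal F_n=\sigma(Z_1,\dots,Z_n)$. All derivatives of $\ell$ are in $\theta$; vector norms are Euclidean, matrix norms are operator 2-norms, and $\lambda_{\min}$ is the smallest eigenvalue of a symmetric matrix. For $\gamma_1>0$ and $\gamma>0$ put $\gamma_n=\gamma_1n^{-\gamma}$. For a deterministic $\theta_0\in\mathbb R^p$, the implicit SGD iterates are $$\theta_n=\operatorname{argmin}_{\theta\in\mathbb R^p}\Big\{\ell(Z_n,\theta)+\tfrac1{2\gamma_n}\|\theta-\theta_{n-1}\|^2\Big\},\qquad n\ge1 .$$ For a symmetric positive definite matrix $A$, $\mathcal L_A^{-1}$ is the inverse of the Lyapunov map $\mathcal L_A(X)=\frac12(AX+XA)$ on $p\times p$ matrices. **Assumptions.** 1. $\ell(z,\cdot)$ is convex for each $z$, and $\ell(\cdot,\theta)$ is integrable for each $\theta$. 2. $\theta_\star$ is a minimizer of $L$. Almost surely,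 $\ell(Z,\cdot)$ is continuously differentiable and $\|\nabla\ell(Z,\theta)-\nabla\ell(Z,\theta_\star)\|\le\beta(Z)\|\theta-\theta_\star\|$ for all $\theta$, with $\mathbf E[\beta(Z)^2]<\infty$. 3. Almost surely, $\Lambda(Z)\succeq0$ and $\ell(Z,\cdot)$ is $\Lambda(Z)$-convex at $\theta_\star$: $\ell(Z,y)\ge\ell(Z,\theta_\star)+s^T(y-\theta_\star)+\frac12(y-\theta_\star)^T\Lambda(Z)(y-\theta_\star)$ for all $y\in\mathbb R^p$ and all $s\in\partial\ell(Z,\cdot)(\theta_\star)$. Moreover $\Lambda_0=\mathbf E[\Lambda(Z)]$ exists and is positive definite; $\lambda=\lambda_{\min}(\Lambda_0)>0$. 4. $\mathbf E\|\nabla\ell(Z,\theta_\star)\|^2\le\sigma^2<\infty$. 5. $L$ is twice differentiable at $\theta_\star$, with Hessian $\mathcal H=\nabla^2L(\theta_\star)$. 6. With $\varepsilon_n=\nabla L(\theta_{n-1})-\nabla\ell(Z_n,\theta_{n-1})$, there are constants $\Sigma_3,\Sigma_4$ such that for all $n\ge1$, $\|\varepsilon_n\|^4$ is integrable and $\mathbf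 E[\|\varepsilon_n\|^4\mid\mathcal F_{n-1}]\le\Sigma_3+\Sigma_4\|\theta_{n-1}-\theta_\star\|^4$ a.s. 7. Almost surely, $\ell(Z,\cdot)$ is twice differentiable everywhere and $\|\nabla^2\ell(Z,\theta)-\nabla^2\ell(Z,\theta_\star)\|\le M\|\theta-\theta_\star\|$ for all $\theta$, for a constant $M$. 8. $\mathbf E[(\nabla^2\ell(Z,\theta_\star))^2]$ exists and $\|\mathbf E[(\nabla^2\ell(Z,\theta_\star))^2]-\mathcal H^2\|\le L_4$ for a constant $L_4$. **Estimator.** Let $\mathcal I=\mathbf E[\nabla\ell(Z,\theta_\star)\nabla\ell(Z,\theta_\star)^T]$, $$\hat H_n=\frac1n\sum_{k=1}^n\nabla^2\ell(Z_k,\theta_{k-1}),\qquad \hat I_n=\frac1n\sum_{k=1}^n\nabla\ell(Z_k,\theta_{k-1})\nabla\ell(Z_k,\theta_{k-1})^T .$$ Let $\beta_+=1$ if $\gamma=1$ and $\beta_+=0$ otherwise, fix $\delta\in\big(\beta_+/(2\gamma_1),\,\lambda_{\min}(\mathcal H)\big)$, and let $\tilde H_n=Q\operatorname{diag}(\max(d_1,\delta),\dots,\max(d_p,\delta))Q^T$,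 where $\hat H_n=Q\operatorname{diag}(d_1,\dots,d_p)Q^T$ is a spectral decomposition. Put $$\hat\Sigma_n=\gamma_1^2\,\mathcal L^{-1}_{2\gamma_1\tilde H_n-\beta_+I}(\hat I_n),\qquad \Sigma=\gamma_1^2\,\mathcal L^{-1}_{2\gamma_1\mathcal H-\beta_+I}(\mathcal I).$$ **Theorem (Consistency of the plug-in estimator).** Under these assumptions, suppose that either $\gamma=1$, $\gamma_1\ge(e^2-1)/\lambda$ and $2\gamma_1\mathcal H\succ I$, or $\gamma\in(\frac12,1)$. Then there is a constant $c>0$ such that for all $n\ge1$, $\hat\Sigma_n-\Sigma$ is integrable and $$\mathbf E\|\hat\Sigma_n-\Sigma\|\le c\,\gamma_n^{1/2}.$$ -/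

import Mathlib

open MeasureTheory ProbabilityTheory Filter Topology
open scoped Matrix.Norms.L2Operator

/-- The parameter space `ℝ^p` with its Euclidean norm. -/
abbrev Vec (p : ℕ) : Type := EuclideanSpace ℝ (Fin p)

/-- Real `p × p` matrices. Through the scoped instances opened above, the norm `‖A‖` is the
operator 2-norm. -/
abbrev Mat (p : ℕ) : Type := Matrix (Fin p) (Fin p) ℝ

noncomputable section

/-! ### Deterministic notions -/

/-- `f` is differentiable near `x` and its derivative is differentiable at `x`. -/
def TwiceDifferentiableAt {p : ℕ} (f : Vec p → ℝ) (x : Vec p) : Prop :=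
  (∀ᶠ y in 𝓝 x, DifferentiableAt ℝ f y) ∧ DifferentiableAt ℝ (fderiv ℝ f) x

/-- The Hessian matrix of `f` at `x`, in the standard basis. -/
def hessian {p : ℕ} (f : Vec p → ℝ) (x : Vec p) : Mat p :=
  Matrix.of fun i j =>
    fderiv ℝ (fderiv ℝ f) x (EuclideanSpace.single i 1) (EuclideanSpace.single j 1)

/-- The outer product `v vᵀ`. -/
def outer {p : ℕ} (v : Vec p) : Mat p := Matrix.of fun i j => v i * v j

/-- The smallest eigenvalue of a symmetric matrix (of size at least one). -/
def lambdaMin {p : ℕ} (A : Mat p) : ℝ := sInf (spectrum ℝ A)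

/-- `s` is a subgradient of `f` at `x`. -/
def IsSubgradient {p : ℕ} (f : Vec p → ℝ) (x s : Vec p) : Prop :=
  ∀ y, f x + inner ℝ s (y - x) ≤ f y

/-- `f` is `M`-convex at `x`: for every `s ∈ ∂f(x)` and every `y`,
`f y ≥ f x + sᵀ (y - x) + (1/2) (y - x)ᵀ M (y - x)`. -/
def MConvexAt {p : ℕ} (f : Vec p → ℝ) (M : Mat p) (x : Vec p) : Prop :=
  ∀ s, IsSubgradient f x s → ∀ y,
    f x + inner ℝ s (y - x) + (1 / 2) * ∑ i, ∑ j, (y - x) i * M i j * (y - x) j ≤ f y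

/-- The proximity operator: a minimizer of `u ↦ f u + ‖u - x‖² / (2 c)`
(for `f` convex and `c > 0` it exists and is unique). -/
def prox {p : ℕ} (c : ℝ) (f : Vec p → ℝ) (x : Vec p) : Vec p :=
  Classical.epsilon fun y => IsMinOn (fun u => f u + 1 / (2 * c) * ‖u - x‖ ^ 2) Set.univ y

/-- The Lyapunov map `X ↦ (1/2) (P X + X P)`, as a linear endomorphism of the matrix space. -/
def lyapunov {p : ℕ} (P : Mat p) : Module.End ℝ (Mat p) :=
  (1 / 2 : ℝ) • (LinearMap.mulLeft ℝ P + LinearMap.mulRight ℝ P)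

/-- The inverse operator of the Lyapunov map (`Ring.inverse` is the two-sided inverse, under
composition, of an invertible endomorphism; the map is invertible for `P` positive definite). -/
def lyapunovInv {p : ℕ} (P : Mat p) : Module.End ℝ (Mat p) := Ring.inverse (lyapunov P)

open scoped Classical in
/-- Flooring of the eigenvalues of a symmetric matrix at `δ`: if `A = U diag(d) Uᵀ` is the spectral
decomposition, this is `U diag(max(d_i, δ)) Uᵀ`. -/
def eigFloor {p : ℕ} (δ : ℝ) (A : Mat p) : Mat p :=
  if hA : A.IsHermitian then
    (hA.eigenvectorUnitary : Mat p) * Matrix.diagonal (fun i => max (hA.eigenvalues i) δ) *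
      star (hA.eigenvectorUnitary : Mat p)
  else A

/-- The learning rate `γ_n = γ₁ n^{-γ}`. -/
def stepSize (γ₁ γ : ℝ) (n : ℕ) : ℝ := γ₁ * (n : ℝ) ^ (-γ)

/-- `β₊ = 1` if `γ = 1` and `β₊ = 0` otherwise. -/
def betaPlus (γ : ℝ) : ℝ := if γ = 1 then 1 else 0

/-- `γ₁² 𝓛⁻¹_{2 γ₁ H - β₊ I} (J)`. -/
def covMap {p : ℕ} (γ₁ γ : ℝ) (H J : Mat p) : Mat p :=
  γ₁ ^ 2 • lyapunovInv ((2 * γ₁) • H - betaPlus γ • (1 : Mat p)) J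

/-! ### The stochastic problem

`ℓ z θ` is the sample function and `P` the law of the data. -/

variable {p : ℕ} {S : Type*} [MeasurableSpace S]

/-- The objective `L(θ) = E[ℓ(Z, θ)]`. -/
def risk (P : Measure S) (ℓ : S → Vec p → ℝ) (θ : Vec p) : ℝ := ∫ z, ℓ z θ ∂P

/-- `𝓘(θ) = E[∇ℓ(Z, θ) ∇ℓ(Z, θ)ᵀ]`. -/
def infoMat (P : Measure S) (ℓ : S → Vec p → ℝ) (θ : Vec p) : Mat p :=
  ∫ z, outer (gradient (ℓ z) θ) ∂P

/-- The implicit SGD (proximal Robbins-Monro) iterates along a data sequence. The data are indexed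
from `0`: the point `z n` here is the `(n+1)`-st observation, and
`θ_{n+1} = prox_{γ_{n+1} ℓ(z n, ·)} (θ_n)`. -/
def proxRM (ℓ : S → Vec p → ℝ) (γ₁ γ : ℝ) (θ₀ : Vec p) (z : ℕ → S) : ℕ → Vec p
  | 0 => θ₀
  | n + 1 => prox (stepSize γ₁ γ (n + 1)) (ℓ (z n)) (proxRM ℓ γ₁ γ θ₀ z n)

/-- `Ĥ_n`, the average of the first `n` sample Hessians, each taken at the iterate that precedes
the observation. -/
def hatH (ℓ : S → Vec p → ℝ) (γ₁ γ : ℝ) (θ₀ : Vec p) (z : ℕ → S) (n : ℕ) : Mat p :=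
  (1 / (n : ℝ)) • ∑ k ∈ Finset.range n, hessian (ℓ (z k)) (proxRM ℓ γ₁ γ θ₀ z k)

/-- `Î_n`, the average of the first `n` outer products of sample gradients, each taken at the
iterate that precedes the observation. -/
def hatI (ℓ : S → Vec p → ℝ) (γ₁ γ : ℝ) (θ₀ : Vec p) (z : ℕ → S) (n : ℕ) : Mat p :=
  (1 / (n : ℝ)) • ∑ k ∈ Finset.range n, outer (gradient (ℓ (z k)) (proxRM ℓ γ₁ γ θ₀ z k))

/-- The plug-in estimator `γ₁² 𝓛⁻¹_{2 γ₁ H̃_n - β₊ I} (Î_n)`, where `H̃_n` is `Ĥ_n` with its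
eigenvalues floored at `δ`. -/
def plugIn (ℓ : S → Vec p → ℝ) (γ₁ γ : ℝ) (θ₀ : Vec p) (δ : ℝ) (z : ℕ → S) (n : ℕ) : Mat p :=
  covMap γ₁ γ (eigFloor δ (hatH ℓ γ₁ γ θ₀ z n)) (hatI ℓ γ₁ γ θ₀ z n)

/-- The asymptotic covariance matrix `Σ = γ₁² 𝓛⁻¹_{2 γ₁ 𝓗(θ⋆) - β₊ I} (𝓘(θ⋆))`. -/
def asymptoticCov (P : Measure S) (ℓ : S → Vec p → ℝ) (γ₁ γ : ℝ) (θs : Vec p) : Mat p :=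
  covMap γ₁ γ (hessian (risk P ℓ) θs) (infoMat P ℓ θs)

/-! ### Assumptions -/

/-- Convexity and integrability of the sample function. -/
structure ConvexIntegrable (P : Measure S) (ℓ : S → Vec p → ℝ) : Prop where
  convex : ∀ z, ConvexOn ℝ Set.univ (ℓ z)
  integrable : ∀ θ, Integrable (fun z => ℓ z θ) P

/-- `ℓ(Z, ·)` is a.s. `β(Z)`-smooth around `θ⋆`, with `E[β(Z)²] < ∞`. -/
structure SmoothAround (P : Measure S) (ℓ : S → Vec p → ℝ) (θs : Vec p) (β : S → ℝ) : Prop where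
  memLp : MemLp β 2 P
  contDiff : ∀ᵐ z ∂P, ContDiff ℝ 1 (ℓ z)
  lipschitz : ∀ᵐ z ∂P, ∀ θ,
    ‖gradient (ℓ z) θ - gradient (ℓ z) θs‖ ≤ β z * ‖θ - θs‖

/-- `θ⋆` minimizes `L`, and `ℓ(Z, ·)` is a.s. `Λ(Z)`-convex at `θ⋆` with `Λ(Z) ⪰ 0` and
`E[Λ(Z)] ≻ 0`. -/
structure MatrixConvex (P : Measure S) (ℓ : S → Vec p → ℝ) (θs : Vec p) (Λ : S → Mat p) :
    Prop where
  minimizer : IsMinOn (risk P ℓ) Set.univ θs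
  posSemidef : ∀ᵐ z ∂P, (Λ z).PosSemidef
  convexAt : ∀ᵐ z ∂P, MConvexAt (ℓ z) (Λ z) θs
  integrable : Integrable Λ P
  posDef : (∫ z, Λ z ∂P).PosDef

/-- `E‖∇ℓ(Z, θ⋆)‖² ≤ σ² < ∞`. -/
structure NoiseBound (P : Measure S) (ℓ : S → Vec p → ℝ) (θs : Vec p) (σ : ℝ) : Prop where
  memLp : MemLp (fun z => gradient (ℓ z) θs) 2 P
  bound : ∫ z, ‖gradient (ℓ z) θs‖ ^ 2 ∂P ≤ σ ^ 2

/-- The `σ`-algebra generated by the first `n` observations. -/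
abbrev pastSigma {Ω : Type*} (Z : ℕ → Ω → S) (n : ℕ) : MeasurableSpace Ω :=
  ⨆ k ∈ Finset.range n, MeasurableSpace.comap (Z k) inferInstance

/-- The stochastic error `∇L(θ_n) - ∇ℓ(Z, θ_n)`, where `Z` is the `(n+1)`-st observation. -/
def gradError (P : Measure S) (ℓ : S → Vec p → ℝ) (γ₁ γ : ℝ) (θ₀ : Vec p) (z : ℕ → S) (n : ℕ) :
    Vec p :=
  gradient (risk P ℓ) (proxRM ℓ γ₁ γ θ₀ z n) - gradient (ℓ (z n)) (proxRM ℓ γ₁ γ θ₀ z n)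

/-- Conditional fourth moment bound on the stochastic errors. -/
structure FourthMoment {Ω : Type*} [MeasurableSpace Ω] (μ : Measure Ω) (P : Measure S)
    (ℓ : S → Vec p → ℝ) (γ₁ γ : ℝ) (θ₀ θs : Vec p) (Z : ℕ → Ω → S) (s₃ s₄ : ℝ) : Prop where
  integrable : ∀ n, Integrable (fun ω => ‖gradError P ℓ γ₁ γ θ₀ (fun k => Z k ω) n‖ ^ 4) μ
  bound : ∀ n, μ[fun ω => ‖gradError P ℓ γ₁ γ θ₀ (fun k => Z k ω) n‖ ^ 4 | pastSigma Z n]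
    ≤ᵐ[μ] fun ω => s₃ + s₄ * ‖proxRM ℓ γ₁ γ θ₀ (fun k => Z k ω) n - θs‖ ^ 4

/-- `ℓ(Z, ·)` is a.s. twice differentiable, with Hessian `M`-Lipschitz at `θ⋆`. -/
structure HessianLipschitz (P : Measure S) (ℓ : S → Vec p → ℝ) (θs : Vec p) (M : ℝ) : Prop where
  twice : ∀ᵐ z ∂P, ∀ θ, TwiceDifferentiableAt (ℓ z) θ
  lipschitz : ∀ᵐ z ∂P, ∀ θ, ‖hessian (ℓ z) θ - hessian (ℓ z) θs‖ ≤ M * ‖θ - θs‖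

/-- The second moment of the sample Hessian at `θ⋆` exists and
`‖E[(∇²ℓ(Z, θ⋆))²] - 𝓗(θ⋆)²‖ ≤ L₄`. -/
structure HessianMoment (P : Measure S) (ℓ : S → Vec p → ℝ) (θs : Vec p) (L₄ : ℝ) : Prop where
  integrable : Integrable (fun z => hessian (ℓ z) θs ^ 2) P
  bound : ‖(∫ z, hessian (ℓ z) θs ^ 2 ∂P) - hessian (risk P ℓ) θs ^ 2‖ ≤ L₄

end

/-! Both the estimator and its target are values of one map, `(H, J) ↦ covMap γ₁ γ H J`. The rate
therefore follows from a stability estimate for this map together with `O(n^{-γ/2})` rates in `L¹`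
for `hatH` and `hatI`.

Stability is proved in the Frobenius norm. Flooring the eigenvalues is the metric projection onto
the convex set `{X | X ⪰ δ I}`, which contains the true Hessian, so flooring does not increase the
error. On that set `2 γ₁ H - β₊ I` is bounded below by a positive multiple of the identity and the
Lyapunov map is coercive. The error of the solution solves a Lyapunov equation whose right side is
linear in the errors of `H` and `J`, with coefficients that involve only the exact solution
(`exists_covMap_sub_le`). No product of random errors appears, so first moments suffice.

For the iterates, a proximal step satisfies the usual inequality of a gradient step, with function
and gradient taken at the old point (`norm_prox_sub_sq_le`). The old point is independent of the new
observation; averaging and using quadratic growth of the risk gives a scalar recursion, and a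
Chung-type lemma yields `E‖θ_n - θ⋆‖² = O(n^{-γ})`.

Each empirical matrix then splits into an i.i.d. mean at `θ⋆`, of order `n^{-1/2}`, and an average
of increments controlled by `‖θ_k - θ⋆‖` (`hatH_rate`, `hatI_rate`). The i.i.d. mean of gradient
outer products needs a fourth moment of the gradient at `θ⋆`. It is extracted from the moment
condition along the iterates: these visit every neighbourhood of `θ⋆` with positive probability, and
Fatou's lemma passes to the limit (`exists_fourth_moment_near`,
`lintegral_gradient_pow_four_lt_top`).

Almost sure hypotheses are turned into sure ones by relocating a null set of observations
(`exists_retraction`). -/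

noncomputable section

open scoped Matrix

/-! ### Linear algebra -/

/-- The entries of a matrix as a Euclidean vector: its norm is the Frobenius norm. -/
def fvec {p : ℕ} : Mat p →ₗ[ℝ] EuclideanSpace ℝ (Fin p × Fin p) where
  toFun A := WithLp.toLp 2 fun ij => A ij.1 ij.2
  map_add' _ _ := rfl
  map_smul' _ _ := rfl

@[simp] lemma fvec_apply {p : ℕ} (A : Mat p) (ij : Fin p × Fin p) : fvec A ij = A ij.1 ij.2 := rfl

lemma inner_fvec {p : ℕ} (A B : Mat p) : inner ℝ (fvec A) (fvec B) = (Aᵀ * B).trace := by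
  simp only [PiLp.inner_apply, fvec_apply, RCLike.inner_apply, conj_trivial, Matrix.trace,
    Matrix.diag_apply, Matrix.mul_apply, Matrix.transpose_apply, Fintype.sum_prod_type]
  rw [Finset.sum_comm]
  exact Finset.sum_congr rfl fun i _ => Finset.sum_congr rfl fun j _ => mul_comm _ _

lemma fvec_injective {p : ℕ} : Function.Injective (fvec (p := p)) := by
  intro A B h
  ext i j
  exact congrArg (fun v : EuclideanSpace ℝ (Fin p × Fin p) => v (i, j)) h

lemma norm_fvec_le {p : ℕ} (A : Mat p) : ‖fvec A‖ ≤ ∑ i, ∑ j, |A i j| := by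
  have h : fvec A = ∑ ij : Fin p × Fin p, EuclideanSpace.single ij (A ij.1 ij.2) := by
    ext ij
    simp
  rw [h, ← Fintype.sum_prod_type' (f := fun i j => |A i j|)]
  refine (norm_sum_le _ _).trans (Finset.sum_le_sum fun ij _ => ?_)
  simp

lemma mat_eq_sum_smul_single {p : ℕ} (A : Mat p) :
    A = ∑ i, ∑ j, A i j • Matrix.single i j (1 : ℝ) := by
  conv_lhs => rw [Matrix.matrix_eq_sum_single A]
  simp [Matrix.smul_single]

lemma exists_norm_le_fvec (p : ℕ) : ∃ C : ℝ, 0 < C ∧ ∀ A : Mat p, ‖A‖ ≤ C * ‖fvec A‖ := by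
  refine ⟨1 + ∑ i : Fin p, ∑ j : Fin p, ‖Matrix.single i j (1 : ℝ)‖, by positivity, fun A => ?_⟩
  have hA := mat_eq_sum_smul_single A
  have hent : ∀ i j, |A i j| ≤ ‖fvec A‖ := fun i j => by
    simpa using PiLp.norm_apply_le (fvec A) (i, j)
  calc ‖A‖ = ‖∑ i, ∑ j, A i j • Matrix.single i j (1 : ℝ)‖ := by rw [← hA]
    _ ≤ ∑ i, ∑ j, ‖A i j • Matrix.single i j (1 : ℝ)‖ :=
        (norm_sum_le _ _).trans (Finset.sum_le_sum fun i _ => norm_sum_le _ _)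
    _ ≤ ∑ i, ∑ j, ‖Matrix.single i j (1 : ℝ)‖ * ‖fvec A‖ := by
        refine Finset.sum_le_sum fun i _ => Finset.sum_le_sum fun j _ => ?_
        rw [norm_smul, mul_comm]
        exact mul_le_mul_of_nonneg_left (hent i j) (norm_nonneg _)
    _ = (∑ i : Fin p, ∑ j : Fin p, ‖Matrix.single i j (1 : ℝ)‖) * ‖fvec A‖ := by
        simp only [Finset.sum_mul]
    _ ≤ _ := by
        have := norm_nonneg (fvec A)
        nlinarith

/-! ### Flooring of eigenvalues as a projection. -/

/-- `A ⪰ a I`. -/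
def GeScalar {p : ℕ} (a : ℝ) (A : Mat p) : Prop := (A - a • (1 : Mat p)).PosSemidef

lemma GeScalar.le_dotProduct {p : ℕ} {a : ℝ} {A : Mat p} (h : GeScalar a A) (x : Fin p → ℝ) :
    a * (x ⬝ᵥ x) ≤ x ⬝ᵥ (A *ᵥ x) := by
  have := h.dotProduct_mulVec_nonneg x
  simp only [star_trivial, Matrix.sub_mulVec, Matrix.smul_mulVec, Matrix.one_mulVec,
    dotProduct_sub, dotProduct_smul, smul_eq_mul] at this
  linarith

/-- In an eigenbasis of `A` the trace is the sum of the eigenvalues of `A` times the diagonal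
entries of a conjugate of `B`, all nonnegative. -/
lemma trace_mul_nonneg {p : ℕ} {A B : Mat p} (hA : A.PosSemidef) (hB : B.PosSemidef) :
    0 ≤ (A * B).trace := by
  set U : Mat p := (hA.1.eigenvectorUnitary : Mat p) with hU
  have hspec : A = U * Matrix.diagonal hA.1.eigenvalues * star U := by
    have := hA.1.spectral_theorem
    rw [Unitary.conjStarAlgAut_apply] at this
    exact this
  have h1 : (A * B).trace = (Matrix.diagonal hA.1.eigenvalues * (star U * B * U)).trace := by
    calc (A * B).trace = (U * Matrix.diagonal hA.1.eigenvalues * star U * B).trace := by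
          rw [← hspec]
      _ = _ := by
          simp only [Matrix.mul_assoc]
          rw [Matrix.trace_mul_comm]
          simp only [Matrix.mul_assoc]
  have h2 : (star U * B * U).PosSemidef := hB.conjTranspose_mul_mul_same U
  rw [h1, Matrix.trace]
  refine Finset.sum_nonneg fun i _ => ?_
  rw [Matrix.diag_apply, Matrix.diagonal_mul]
  exact mul_nonneg (hA.eigenvalues_nonneg i) h2.diag_nonneg

/-- These are the optimality conditions of the projection onto `{X | X ⪰ δ I}`: feasibility, sign of
the multiplier, complementary slackness. All three matrices are diagonal in one eigenbasis, and for
each eigenvalue `max d δ` equals `d` or `δ`, which kills the product. -/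
lemma eigFloor_decomp {p : ℕ} (δ : ℝ) {A : Mat p} (hA : A.IsHermitian) :
    GeScalar δ (eigFloor δ A) ∧ (eigFloor δ A - A).PosSemidef ∧
      (eigFloor δ A - A) * (eigFloor δ A - δ • (1 : Mat p)) = 0 := by
  set U : Mat p := (hA.eigenvectorUnitary : Mat p) with hU
  have hUU : star U * U = 1 := Unitary.coe_star_mul_self hA.eigenvectorUnitary
  have hUU' : U * star U = 1 := Unitary.coe_mul_star_self hA.eigenvectorUnitary
  have hfl : eigFloor δ A =
      U * Matrix.diagonal (fun i => max (hA.eigenvalues i) δ) * star U := by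
    rw [eigFloor, dif_pos hA]
  have hspec : A = U * Matrix.diagonal hA.eigenvalues * star U := by
    have := hA.spectral_theorem
    rw [Unitary.conjStarAlgAut_apply] at this
    exact this
  have hone : δ • (1 : Mat p) = U * Matrix.diagonal (fun _ => δ) * star U := by
    have : Matrix.diagonal (fun _ : Fin p => δ) = δ • (1 : Mat p) := by
      ext i j; simp [Matrix.diagonal_apply, Matrix.one_apply]
    rw [this, Matrix.mul_smul, Matrix.mul_one, Matrix.smul_mul, hUU']
  have h1 : eigFloor δ A - δ • (1 : Mat p) =
      U * Matrix.diagonal (fun i => max (hA.eigenvalues i) δ - δ) * star U := by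
    rw [hfl, hone, ← Matrix.sub_mul, ← Matrix.mul_sub, Matrix.diagonal_sub]
  have h2 : eigFloor δ A - A =
      U * Matrix.diagonal (fun i => max (hA.eigenvalues i) δ - hA.eigenvalues i) * star U := by
    calc eigFloor δ A - A = U * Matrix.diagonal (fun i => max (hA.eigenvalues i) δ) * star U -
          U * Matrix.diagonal hA.eigenvalues * star U := by rw [← hspec, hfl]
      _ = _ := by rw [← Matrix.sub_mul, ← Matrix.mul_sub, Matrix.diagonal_sub]
  refine ⟨?_, ?_, ?_⟩
  · rw [GeScalar, h1]
    refine (Matrix.PosSemidef.diagonal fun i => ?_).mul_mul_conjTranspose_same U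
    simp
  · rw [h2]
    refine (Matrix.PosSemidef.diagonal fun i => ?_).mul_mul_conjTranspose_same U
    simp
  · rw [h1, h2]
    have : ∀ D E : Mat p, U * D * star U * (U * E * star U) = U * (D * E) * star U := by
      intro D E
      calc U * D * star U * (U * E * star U) = U * D * (star U * U) * E * star U := by
            simp only [Matrix.mul_assoc]
        _ = _ := by rw [hUU]; simp only [Matrix.mul_assoc, Matrix.one_mul]
    rw [this, Matrix.diagonal_mul_diagonal]
    have hz : (fun i => (max (hA.eigenvalues i) δ - hA.eigenvalues i) *
        (max (hA.eigenvalues i) δ - δ)) = 0 := by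
      ext i
      rcases le_total (hA.eigenvalues i) δ with h | h <;> simp [h]
    rw [hz]
    simp

/-- Flooring the eigenvalues is the Frobenius projection onto `{X | X ⪰ δ I}`. -/
lemma inner_sub_eigFloor_nonpos {p : ℕ} {δ : ℝ} {A X : Mat p} (hA : A.IsHermitian)
    (hX : GeScalar δ X) :
    inner ℝ (fvec A - fvec (eigFloor δ A)) (fvec X - fvec (eigFloor δ A)) ≤ 0 := by
  obtain ⟨-, h2, h3⟩ := eigFloor_decomp δ hA
  have h4 := trace_mul_nonneg h2 hX
  have hT : (eigFloor δ A - A)ᵀ = eigFloor δ A - A := by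
    have := h2.1.eq
    rwa [Matrix.conjTranspose_eq_transpose_of_trivial] at this
  have h5 : (eigFloor δ A - A) * (X - eigFloor δ A) =
      (eigFloor δ A - A) * (X - δ • (1 : Mat p)) := by
    rw [← sub_zero ((eigFloor δ A - A) * (X - δ • (1 : Mat p))), ← h3, ← Matrix.mul_sub]
    congr 1
    abel
  have h6 : inner ℝ (fvec (eigFloor δ A - A)) (fvec (X - eigFloor δ A)) =
      ((eigFloor δ A - A) * (X - δ • (1 : Mat p))).trace := by
    rw [inner_fvec, hT, h5]
  rw [← neg_sub (fvec (eigFloor δ A)), inner_neg_left, ← map_sub, ← map_sub, h6]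
  linarith

/-- Metric projections onto a convex set are nonexpansive: adding the two variational inequalities
gives `‖x - y‖² ≤ ⟪a - b, x - y⟫`, and Cauchy-Schwarz concludes. -/
lemma norm_sub_le_of_inner_nonpos {E : Type*} [NormedAddCommGroup E] [InnerProductSpace ℝ E]
    {a b x y : E} (h1 : inner ℝ (a - x) (y - x) ≤ 0) (h2 : inner ℝ (b - y) (x - y) ≤ 0) :
    ‖x - y‖ ≤ ‖a - b‖ := by
  have h : ‖x - y‖ ^ 2 ≤ inner ℝ (a - b) (x - y) := by
    have e : inner ℝ (a - b) (x - y) =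
        ‖x - y‖ ^ 2 - inner ℝ (a - x) (y - x) - inner ℝ (b - y) (x - y) := by
      rw [← real_inner_self_eq_norm_sq, ← neg_sub x y, inner_neg_right, sub_neg_eq_add,
        ← inner_add_left, ← inner_sub_left]
      congr 1
      abel
    linarith
  have h3 := real_inner_le_norm (a - b) (x - y)
  by_contra hlt
  push Not at hlt
  nlinarith [norm_nonneg (a - b)]

/-- `H` lies in the set and is its own projection, so the second variational inequality is trivial
and `H` need not be assumed Hermitian. -/
lemma norm_fvec_eigFloor_sub_le {p : ℕ} {δ : ℝ} {A H : Mat p} (hA : A.IsHermitian)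
    (hH : GeScalar δ H) : ‖fvec (eigFloor δ A) - fvec H‖ ≤ ‖fvec A - fvec H‖ :=
  norm_sub_le_of_inner_nonpos (inner_sub_eigFloor_nonpos hA hH) (by simp)

lemma norm_fvec_eigFloor_sub_eigFloor_le {p : ℕ} {δ : ℝ} {A B : Mat p} (hA : A.IsHermitian)
    (hB : B.IsHermitian) :
    ‖fvec (eigFloor δ A) - fvec (eigFloor δ B)‖ ≤ ‖fvec A - fvec B‖ :=
  norm_sub_le_of_inner_nonpos (inner_sub_eigFloor_nonpos hA (eigFloor_decomp δ hB).1)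
    (inner_sub_eigFloor_nonpos hB (eigFloor_decomp δ hA).1)

/-! ### Lyapunov equations and their stability. -/

lemma lyapunov_apply {p : ℕ} (A X : Mat p) :
    lyapunov A X = (1 / 2 : ℝ) • (A * X + X * A) := rfl

/-- The inner product is the mean of `tr(Xᵀ A X)` and `tr(X A Xᵀ)`; each is bounded below column by
column, for `X` and for `Xᵀ`. No symmetry of `X` is needed. -/
lemma GeScalar.le_inner_lyapunov {p : ℕ} {a : ℝ} {A : Mat p} (hA : GeScalar a A) (X : Mat p) :
    a * ‖fvec X‖ ^ 2 ≤ inner ℝ (fvec X) (fvec (lyapunov A X)) := by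
  have hcol : ∀ Y : Mat p, a * (Yᵀ * Y).trace ≤ (Yᵀ * (A * Y)).trace := by
    intro Y
    simp only [Matrix.trace, Matrix.diag_apply, Finset.mul_sum]
    refine Finset.sum_le_sum fun j _ => ?_
    have := hA.le_dotProduct (fun i => Y i j)
    calc a * (Yᵀ * Y) j j = a * ((fun i => Y i j) ⬝ᵥ fun i => Y i j) := by
          simp [Matrix.mul_apply, dotProduct]
      _ ≤ _ := this
      _ = _ := by simp [Matrix.mul_apply, dotProduct, Matrix.mulVec]
  have h1 := hcol X
  have h2 := hcol Xᵀ
  rw [Matrix.transpose_transpose, Matrix.trace_mul_comm, ← Matrix.mul_assoc,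
    Matrix.trace_mul_comm (X * A)] at h2
  rw [← real_inner_self_eq_norm_sq, inner_fvec, inner_fvec, lyapunov_apply, Matrix.mul_smul,
    Matrix.mul_add, Matrix.trace_smul, Matrix.trace_add, smul_eq_mul]
  linarith

lemma GeScalar.mul_norm_le_lyapunov {p : ℕ} {a : ℝ} {A : Mat p} (hA : GeScalar a A) (X : Mat p) :
    a * ‖fvec X‖ ≤ ‖fvec (lyapunov A X)‖ := by
  have h1 := hA.le_inner_lyapunov X
  have h2 := real_inner_le_norm (fvec X) (fvec (lyapunov A X))
  rcases (norm_nonneg (fvec X)).eq_or_lt with h0 | h0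
  · rw [← h0]; simp
  · nlinarith

/-- Coercivity gives injectivity, hence bijectivity in finite dimension, so `Ring.inverse` is a
genuine inverse here and not its default value `0`. -/
lemma GeScalar.lyapunov_lyapunovInv {p : ℕ} {a : ℝ} {A : Mat p} (ha : 0 < a) (hA : GeScalar a A)
    (J : Mat p) : lyapunov A (lyapunovInv A J) = J := by
  have hinj : Function.Injective (lyapunov A) := by
    rw [← LinearMap.ker_eq_bot, LinearMap.ker_eq_bot']
    intro X hX
    have := hA.mul_norm_le_lyapunov X
    rw [hX, map_zero, norm_zero] at this
    have h0 : ‖fvec X‖ ≤ 0 := by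
      by_contra h
      push Not at h
      nlinarith
    exact fvec_injective (by rw [map_zero]; exact norm_le_zero_iff.1 h0)
  have hu : IsUnit (lyapunov A) := by
    rw [Module.End.isUnit_iff]
    exact ⟨hinj, LinearMap.injective_iff_surjective.1 hinj⟩
  have := Ring.mul_inverse_cancel _ hu
  exact LinearMap.congr_fun this J

/-- Local Lipschitz dependence of the solution of a Lyapunov equation on its data. -/
lemma exists_lyapunovInv_sub_le {p : ℕ} {a : ℝ} (ha : 0 < a) {B : Mat p} (hB : GeScalar a B)
    (J' : Mat p) : ∃ K : ℝ, 0 < K ∧ ∀ A J : Mat p, GeScalar a A →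
      ‖fvec (lyapunovInv A J) - fvec (lyapunovInv B J')‖
        ≤ K * (‖fvec A - fvec B‖ + ‖fvec J - fvec J'‖) := by
  set Y := lyapunovInv B J' with hY
  obtain ⟨C, hC0, hC⟩ := exists_norm_le_fvec p
  obtain ⟨C', hC'⟩ : ∃ C' : ℝ, ∀ D : Mat p, ‖fvec D‖ ≤ C' * ‖D‖ := by
    refine ⟨‖LinearMap.toContinuousLinearMap (fvec (p := p))‖, fun D => ?_⟩
    exact (LinearMap.toContinuousLinearMap (fvec (p := p))).le_opNorm D
  have hC'0 : ∀ D : Mat p, ‖fvec D‖ ≤ |C'| * ‖D‖ := fun D =>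
    (hC' D).trans (mul_le_mul_of_nonneg_right (le_abs_self _) (norm_nonneg _))
  have hbil : ∀ D : Mat p, ‖fvec (lyapunov D Y)‖ ≤ |C'| * (C * ‖Y‖) * ‖fvec D‖ := by
    intro D
    have h1 : ‖lyapunov D Y‖ ≤ ‖D‖ * ‖Y‖ := by
      rw [lyapunov_apply, norm_smul]
      have e1 := norm_add_le (D * Y) (Y * D)
      have e2 := Matrix.l2_opNorm_mul D Y
      have e3 := Matrix.l2_opNorm_mul Y D
      norm_num
      linarith
    calc _ ≤ |C'| * ‖lyapunov D Y‖ := hC'0 _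
      _ ≤ |C'| * (‖D‖ * ‖Y‖) := by gcongr
      _ ≤ |C'| * ((C * ‖fvec D‖) * ‖Y‖) := by gcongr; exact hC D
      _ = _ := by ring
  refine ⟨(1 + |C'| * (C * ‖Y‖)) / a, by positivity, fun A J hA => ?_⟩
  set D := lyapunovInv A J - Y with hD
  -- The map `lyapunov` is linear in its matrix, so the perturbation of `B` acts on the fixed
  -- solution `Y` only. This is why the constant depends on `Y` and not on `A` or `J`.
  have h1 : lyapunov A D = (J - J') - lyapunov (A - B) Y := by
    have e : lyapunov (A - B) Y = lyapunov A Y - lyapunov B Y := by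
      simp only [lyapunov_apply, Matrix.sub_mul, Matrix.mul_sub]
      rw [← smul_sub]
      congr 1
      abel
    rw [hD, map_sub, hA.lyapunov_lyapunovInv ha, e, hY, hB.lyapunov_lyapunovInv ha]
    abel
  have h2 := hA.mul_norm_le_lyapunov D
  rw [h1] at h2
  rw [map_sub fvec (J - J')] at h2
  have h3 := (norm_sub_le (fvec (J - J')) (fvec (lyapunov (A - B) Y))).trans
    (add_le_add_right (hbil (A - B)) _)
  rw [← map_sub, ← map_sub, ← map_sub, div_mul_eq_mul_div, le_div_iff₀ ha]
  have k1 : 0 ≤ |C'| * (C * ‖Y‖) := by positivity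
  have k2 := norm_nonneg (fvec (J - J'))
  have k3 := norm_nonneg (fvec (A - B))
  nlinarith

/-- With `c = 2 γ₁` and `b = β₊`, the condition `β₊ / (2 γ₁) < δ` becomes positivity of the
coercivity constant of the Lyapunov map. -/
lemma GeScalar.affine {p : ℕ} {δ : ℝ} {A : Mat p} (h : GeScalar δ A) {c b : ℝ} (hc : 0 ≤ c) :
    GeScalar (c * δ - b) (c • A - b • (1 : Mat p)) := by
  have := Matrix.PosSemidef.smul h hc
  rw [GeScalar]
  convert this using 1
  rw [smul_sub, sub_smul, mul_smul]
  abel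

lemma exists_covMap_sub_le {p : ℕ} {γ₁ γ δ : ℝ} (hγ₁ : 0 < γ₁)
    (hδ : betaPlus γ / (2 * γ₁) < δ) {B : Mat p} (hB : GeScalar δ B) (J' : Mat p) :
    ∃ K : ℝ, 0 < K ∧ ∀ A J : Mat p, GeScalar δ A →
      ‖fvec (covMap γ₁ γ A J) - fvec (covMap γ₁ γ B J')‖
        ≤ K * (‖fvec A - fvec B‖ + ‖fvec J - fvec J'‖) := by
  have ha : 0 < 2 * γ₁ * δ - betaPlus γ := by
    rw [div_lt_iff₀ (by positivity)] at hδ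
    linarith
  obtain ⟨K, hK, h⟩ := exists_lyapunovInv_sub_le ha (hB.affine (b := betaPlus γ)
    (by positivity : 0 ≤ 2 * γ₁)) J'
  refine ⟨γ₁ ^ 2 * (K * (2 * γ₁ + 1)), by positivity, fun A J hA => ?_⟩
  have h1 := h _ J (hA.affine (b := betaPlus γ) (by positivity : 0 ≤ 2 * γ₁))
  have e : fvec ((2 * γ₁) • A - betaPlus γ • (1 : Mat p)) -
      fvec ((2 * γ₁) • B - betaPlus γ • (1 : Mat p)) = (2 * γ₁) • (fvec A - fvec B) := by
    rw [← map_sub, sub_sub_sub_cancel_right, ← smul_sub, map_smul, map_sub]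
  rw [e, norm_smul, Real.norm_of_nonneg (by positivity)] at h1
  rw [covMap, covMap, map_smul, map_smul, ← smul_sub, norm_smul,
    Real.norm_of_nonneg (by positivity), mul_assoc (γ₁ ^ 2)]
  refine mul_le_mul_of_nonneg_left (h1.trans ?_) (by positivity)
  rw [mul_assoc K]
  refine mul_le_mul_of_nonneg_left ?_ hK.le
  have := norm_nonneg (fvec A - fvec B)
  have := norm_nonneg (fvec J - fvec J')
  nlinarith

/-- Flooring below the smallest eigenvalue changes nothing, so `A` inherits the lower bound of
`eigFloor δ A`. -/
lemma geScalar_of_le_lambdaMin {p : ℕ} {δ : ℝ} {A : Mat p} (hA : A.IsHermitian)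
    (h : δ ≤ lambdaMin A) : GeScalar δ A := by
  have hfl : eigFloor δ A = A := by
    have h0 : (fun i => max (hA.eigenvalues i) δ) = hA.eigenvalues := by
      ext i
      refine max_eq_left (h.trans (csInf_le ?_ ?_))
      · exact (hA.spectrum_real_eq_range_eigenvalues ▸ Set.finite_range _).bddBelow
      · rw [hA.spectrum_real_eq_range_eigenvalues]
        exact ⟨i, rfl⟩
    have hs := hA.spectral_theorem
    rw [Unitary.conjStarAlgAut_apply] at hs
    rw [eigFloor, dif_pos hA, h0]
    exact hs.symm
  exact hfl ▸ (eigFloor_decomp δ hA).1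

lemma lambdaMin_pos {p : ℕ} [Nonempty (Fin p)] {A : Mat p} (hA : A.PosDef) : 0 < lambdaMin A := by
  have hr := hA.1.spectrum_real_eq_range_eigenvalues
  have hmem : lambdaMin A ∈ spectrum ℝ A := by
    refine Set.Nonempty.csInf_mem ?_ ?_
    · rw [hr]; exact Set.range_nonempty _
    · rw [hr]; exact Set.finite_range _
  rw [hr] at hmem
  obtain ⟨i, hi⟩ := hmem
  rw [← hi]
  exact hA.eigenvalues_pos i

/-! ### The proximity operator of a differentiable convex function -/

lemma ConvexOn.isSubgradient_gradient {p : ℕ} {f : Vec p → ℝ} (hf : ConvexOn ℝ Set.univ f)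
    {x : Vec p} (hd : DifferentiableAt ℝ f x) : IsSubgradient f x (gradient f x) := by
  intro y
  have hc : ConvexOn ℝ Set.univ (f ∘ AffineMap.lineMap (k := ℝ) x y) := by
    simpa using hf.comp_affineMap (AffineMap.lineMap (k := ℝ) x y)
  have hl : HasDerivAt (AffineMap.lineMap (k := ℝ) x y) (y - x) (0 : ℝ) :=
    AffineMap.hasDerivAt_lineMap
  have hd' : HasFDerivAt f (fderiv ℝ f x) (AffineMap.lineMap (k := ℝ) x y (0 : ℝ)) := by
    rw [AffineMap.lineMap_apply_zero]
    exact hd.hasFDerivAt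
  have h := hc.le_slope_of_hasDerivAt (Set.mem_univ 0) (Set.mem_univ 1) one_pos
    (hd'.comp_hasDerivAt (0 : ℝ) hl)
  rw [slope_def_field] at h
  simp only [Function.comp, AffineMap.lineMap_apply_zero, AffineMap.lineMap_apply_one, sub_zero,
    div_one] at h
  rw [inner_gradient_left]
  linarith

/-- The objective minimized by the proximity operator. -/
def proxObj {p : ℕ} (c : ℝ) (f : Vec p → ℝ) (x u : Vec p) : ℝ :=
  f u + 1 / (2 * c) * ‖u - x‖ ^ 2

lemma continuous_proxObj {p : ℕ} {c : ℝ} {f : Vec p → ℝ} (hf : Continuous f) (x : Vec p) :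
    Continuous (proxObj c f x) := by
  unfold proxObj
  fun_prop

lemma exists_isMinOn_proxObj {p : ℕ} {c : ℝ} (hc : 0 < c) {f : Vec p → ℝ}
    (hf : ConvexOn ℝ Set.univ f) (hd : Differentiable ℝ f) (x : Vec p) :
    ∃ y, IsMinOn (proxObj c f x) Set.univ y := by
  -- Beyond this radius the quadratic term outweighs the linear minorant of `f` at `x`, so the
  -- objective exceeds its value at `x` and minimizing over the compact ball is enough.
  set R : ℝ := 2 * c * ‖gradient f x‖ with hR
  have hR0 : 0 ≤ R := by positivity
  have hcont := continuous_proxObj (c := c) hd.continuous x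
  obtain ⟨y, -, hy⟩ := (isCompact_closedBall x R).exists_isMinOn
    ⟨x, Metric.mem_closedBall_self hR0⟩ hcont.continuousOn
  refine ⟨y, fun u _ => ?_⟩
  by_cases hu : u ∈ Metric.closedBall x R
  · exact hy hu
  · have hyx : proxObj c f x y ≤ proxObj c f x x := hy (Metric.mem_closedBall_self hR0)
    refine hyx.trans ?_
    rw [Metric.mem_closedBall, not_le, dist_eq_norm] at hu
    have h1 := hf.isSubgradient_gradient (hd x) u
    have h2 := abs_le.1 (abs_real_inner_le_norm (gradient f x) (u - x))
    have h3 : 1 / (2 * c) * ‖u - x‖ ^ 2 - ‖gradient f x‖ * ‖u - x‖ =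
        1 / (2 * c) * ‖u - x‖ * (‖u - x‖ - R) := by
      rw [hR]; field_simp
    have h4 : 0 ≤ 1 / (2 * c) * ‖u - x‖ * (‖u - x‖ - R) :=
      mul_nonneg (by positivity) (by linarith)
    simp only [proxObj, sub_self, norm_zero]
    norm_num
    norm_num at h3 h4
    linarith [h2.1]

lemma isMinOn_prox {p : ℕ} {c : ℝ} (hc : 0 < c) {f : Vec p → ℝ}
    (hf : ConvexOn ℝ Set.univ f) (hd : Differentiable ℝ f) (x : Vec p) :
    IsMinOn (proxObj c f x) Set.univ (prox c f x) :=
  Classical.epsilon_spec (exists_isMinOn_proxObj hc hf hd x)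

/-- Quadratic growth of the proximal objective at its minimizer. -/
lemma proxObj_prox_add_le {p : ℕ} {c : ℝ} (hc : 0 < c) {f : Vec p → ℝ}
    (hf : ConvexOn ℝ Set.univ f) (hd : Differentiable ℝ f) (x u : Vec p) :
    proxObj c f x (prox c f x) + 1 / (2 * c) * ‖u - prox c f x‖ ^ 2 ≤ proxObj c f x u := by
  set y := prox c f x with hy
  set Q := 1 / (2 * c) * ‖u - y‖ ^ 2 with hQ
  set D := proxObj c f x u - proxObj c f x y with hD
  have hmin : ∀ w, proxObj c f x y ≤ proxObj c f x w := fun w =>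
    isMinOn_prox hc hf hd x (Set.mem_univ w)
  have hD0 : 0 ≤ D := sub_nonneg.2 (hmin u)
  -- Strong convexity on the segment from `y` to `u`: compare the minimum with the value at
  -- parameter `t` and divide by `t`. The claim is the limit `t → 0`.
  have key : ∀ t : ℝ, 0 < t → t ≤ 1 → (1 - t) * Q ≤ D := by
    intro t ht ht1
    have h1 := hmin ((1 - t) • y + t • u)
    have h2 := hf.2 (Set.mem_univ y) (Set.mem_univ u) (sub_nonneg.2 ht1) ht.le (by ring)
    have h3 : ‖(1 - t) • y + t • u - x‖ ^ 2 =
        (1 - t) * ‖y - x‖ ^ 2 + t * ‖u - x‖ ^ 2 - t * (1 - t) * ‖u - y‖ ^ 2 := by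
      have e1 : (1 - t) • y + t • u - x = (1 - t) • (y - x) + t • (u - x) := by
        simp only [smul_sub, sub_smul, one_smul]; abel
      have e2 : u - y = (u - x) - (y - x) := by abel
      rw [e1, e2, norm_add_sq_real, norm_sub_sq_real (u - x), norm_smul, norm_smul,
        inner_smul_left, inner_smul_right, mul_pow, mul_pow, real_inner_comm (y - x) (u - x)]
      simp only [Real.norm_eq_abs, sq_abs, conj_trivial]
      ring
    simp only [smul_eq_mul] at h2
    have h4 : proxObj c f x ((1 - t) • y + t • u) ≤
        (1 - t) * proxObj c f x y + t * proxObj c f x u - t * (1 - t) * Q := by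
      rw [proxObj, h3, proxObj, proxObj, hQ]
      linarith
    have h5 : t * ((1 - t) * Q) ≤ t * D := by
      rw [hD]
      linarith
    exact le_of_mul_le_mul_left h5 ht
  have hQD : Q ≤ D := by
    by_contra hlt
    push Not at hlt
    have hQ0 : 0 < Q := hD0.trans_lt hlt
    -- This `t` makes `(1 - t) * Q` the midpoint of `Q` and `D`, which exceeds `D` if `D < Q`.
    have := key ((Q - D) / (2 * Q)) (div_pos (by linarith) (by linarith))
      ((div_le_one (by linarith)).2 (by linarith))
    have e : (1 - (Q - D) / (2 * Q)) * Q = (Q + D) / 2 := by field_simp; ring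
    linarith
  linarith

/-- One step of the proximal iteration. -/
lemma norm_prox_sub_sq_le {p : ℕ} {c : ℝ} (hc : 0 < c) {f : Vec p → ℝ}
    (hf : ConvexOn ℝ Set.univ f) (hd : Differentiable ℝ f) (x w : Vec p) :
    ‖prox c f x - w‖ ^ 2 ≤ ‖x - w‖ ^ 2 - 2 * c * (f x - f w) + c ^ 2 * ‖gradient f x‖ ^ 2 := by
  set y := prox c f x with hy
  have h1 := proxObj_prox_add_le hc hf hd x w
  rw [← hy] at h1
  simp only [proxObj] at h1
  -- Convexity at the old point `x` replaces `f y` by `f x`, which does not depend on the step. The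
  -- resulting cross term and `‖y - x‖²` are absorbed by the square in `h3`, at the cost `c²
  -- ‖∇f(x)‖²`.
  have h2 := hf.isSubgradient_gradient (hd x) y
  have h3 : 0 ≤ ‖c • gradient f x + (y - x)‖ ^ 2 := by positivity
  rw [norm_add_sq_real, norm_smul, inner_smul_left, mul_pow] at h3
  simp only [Real.norm_eq_abs, sq_abs, conj_trivial] at h3
  have h4 := mul_le_mul_of_nonneg_left h1 (by positivity : 0 ≤ 2 * c)
  have e : ∀ a b : ℝ, 2 * c * (a + 1 / (2 * c) * b) = 2 * c * a + b := by
    intro a b; field_simp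
  rw [add_assoc, ← mul_add, e, e, norm_sub_rev w y, norm_sub_rev w x] at h4
  have h5 := mul_le_mul_of_nonneg_left h2 (by positivity : 0 ≤ 2 * c)
  linarith

/-! ### Measurability of the proximity operator -/

/-- The best of the first points of a sequence. -/
def runningArgmin {E : Type*} (q : ℕ → E) (F : E → ℝ) : ℕ → E
  | 0 => q 0
  | n + 1 => if F (q (n + 1)) < F (runningArgmin q F n) then q (n + 1) else runningArgmin q F n

lemma runningArgmin_le {E : Type*} (q : ℕ → E) (F : E → ℝ) {k n : ℕ} (h : k ≤ n) :
    F (runningArgmin q F n) ≤ F (q k) := by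
  induction n with
  | zero => rw [Nat.le_zero.1 h]; rfl
  | succ n ih =>
    rw [runningArgmin]
    split_ifs with hlt
    · rcases h.eq_or_lt with rfl | h'
      · rfl
      · exact hlt.le.trans (ih (Nat.lt_succ_iff.1 h'))
    · rcases h.eq_or_lt with rfl | h'
      · exact not_lt.1 hlt
      · exact ih (Nat.lt_succ_iff.1 h')

lemma measurable_runningArgmin {T E : Type*} [MeasurableSpace T] [MeasurableSpace E]
    (q : ℕ → E) {F : T → E → ℝ} (hF : Measurable (Function.uncurry F)) (n : ℕ) :
    Measurable fun t => runningArgmin q (F t) n := by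
  induction n with
  | zero => exact measurable_const
  | succ n ih =>
    refine Measurable.ite (measurableSet_lt ?_ ?_) measurable_const ih
    · exact hF.comp (measurable_id.prodMk measurable_const)
    · exact hF.comp (measurable_id.prodMk ih)

lemma tendsto_runningArgmin {E : Type*} [TopologicalSpace E] {q : ℕ → E} (hq : DenseRange q)
    {F : E → ℝ} (hF : Continuous F) {y : E} (hy : ∀ u, F y ≤ F u) :
    Tendsto (fun n => F (runningArgmin q F n)) atTop (𝓝 (F y)) := by
  refine tendsto_order.2 ⟨fun a ha => Eventually.of_forall fun n => ha.trans_le (hy _),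
    fun a ha => ?_⟩
  obtain ⟨k, hk⟩ := hq.exists_mem_open (hF.isOpen_preimage _ isOpen_Iio) ⟨y, ha⟩
  filter_upwards [eventually_ge_atTop k] with n hn
  exact (runningArgmin_le q F hn).trans_lt hk

lemma measurable_uncurry_sample {p : ℕ} {S : Type*} [MeasurableSpace S] {ℓ : S → Vec p → ℝ}
    (hm : ∀ θ, Measurable fun z => ℓ z θ) (hc : ∀ z, Continuous (ℓ z)) :
    Measurable (Function.uncurry ℓ) :=
  (measurable_uncurry_of_continuous_of_measurable (u := fun θ z => ℓ z θ) hc hm).comp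
    measurable_swap

/-- The choice in `prox` is harmless because the problem is well posed: by quadratic growth every
minimizing sequence converges to the minimizer. The best points of a dense sequence form a
measurable minimizing sequence. -/
lemma measurable_prox {p : ℕ} {S : Type*} [MeasurableSpace S] {ℓ : S → Vec p → ℝ} {c : ℝ}
    (hc : 0 < c) (hm : ∀ θ, Measurable fun z => ℓ z θ) (hf : ∀ z, ConvexOn ℝ Set.univ (ℓ z))
    (hd : ∀ z, Differentiable ℝ (ℓ z)) :
    Measurable fun zx : S × Vec p => prox c (ℓ zx.1) zx.2 := by
  set F : S × Vec p → Vec p → ℝ := fun zx => proxObj c (ℓ zx.1) zx.2 with hFdef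
  have hcont : ∀ zx, Continuous (F zx) := fun zx =>
    continuous_proxObj (hd zx.1).continuous zx.2
  have hF : Measurable (Function.uncurry F) := by
    have h1 : Measurable fun t : (S × Vec p) × Vec p => ℓ t.1.1 t.2 :=
      (measurable_uncurry_sample hm fun z => (hd z).continuous).comp
        ((measurable_fst.comp measurable_fst).prodMk measurable_snd)
    exact h1.add (((measurable_snd.sub (measurable_snd.comp measurable_fst)).norm.pow_const
      2).const_mul _)
  refine measurable_of_tendsto_metrizable
    (fun n => measurable_runningArgmin (TopologicalSpace.denseSeq (Vec p)) hF n)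
    (tendsto_pi_nhds.2 fun zx => ?_)
  set y := prox c (ℓ zx.1) zx.2 with hy
  have hlim := tendsto_runningArgmin (TopologicalSpace.denseRange_denseSeq (Vec p)) (hcont zx)
    (y := y) fun u => isMinOn_prox hc (hf zx.1) (hd zx.1) zx.2 (Set.mem_univ u)
  have hgap : ∀ u, ‖u - y‖ ^ 2 ≤ 2 * c * (F zx u - F zx y) := by
    intro u
    have := proxObj_prox_add_le hc (hf zx.1) (hd zx.1) zx.2 u
    have h2 := mul_le_mul_of_nonneg_left this (by positivity : 0 ≤ 2 * c)
    have e : ∀ a b : ℝ, 2 * c * (a + 1 / (2 * c) * b) = 2 * c * a + b := by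
      intro a b; field_simp
    rw [e] at h2
    simp only [hFdef]
    linarith
  rw [tendsto_iff_norm_sub_tendsto_zero]
  have h0 : Tendsto (fun n => 2 * c * (F zx (runningArgmin (TopologicalSpace.denseSeq (Vec p))
      (F zx) n) - F zx y)) atTop (𝓝 0) := by
    simpa using (hlim.sub_const (F zx y)).const_mul (2 * c)
  have h1 := squeeze_zero (fun n => by positivity) (fun n => hgap _) h0
  have h2 := (Real.continuous_sqrt.tendsto 0).comp h1
  simpa [Function.comp_def, Real.sqrt_sq] using h2

/-! ### Derivatives of the sample function and of the risk -/

lemma hessian_apply {p : ℕ} {f : Vec p → ℝ} {x : Vec p} (h : DifferentiableAt ℝ (fderiv ℝ f) x)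
    (i j : Fin p) : hessian f x i j =
      fderiv ℝ (fun y => fderiv ℝ f y (EuclideanSpace.single j 1)) x
        (EuclideanSpace.single i 1) := by
  rw [fderiv_clm_apply h (differentiableAt_const _)]
  simp [hessian]

lemma TwiceDifferentiableAt.hessian_isHermitian {p : ℕ} {f : Vec p → ℝ} {x : Vec p}
    (h : TwiceDifferentiableAt f x) : (hessian f x).IsHermitian := by
  ext i j
  simp only [Matrix.conjTranspose_apply, star_trivial, hessian, Matrix.of_apply]
  exact second_derivative_symmetric_of_eventually_of_real
    (h.1.mono fun y hy => hy.hasFDerivAt) h.2.hasFDerivAt _ _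

/-- A directional derivative is the limit of the difference quotients with step `1/n`. Applied
twice, this reaches second derivatives without assuming them continuous. -/
lemma measurable_fderiv_apply_of_measurable {p : ℕ} {S : Type*} [MeasurableSpace S]
    {G : S → Vec p → ℝ} (hG : Measurable (Function.uncurry G))
    (hd : ∀ z, Differentiable ℝ (G z)) (v : Vec p) :
    Measurable fun zx : S × Vec p => fderiv ℝ (G zx.1) zx.2 v := by
  refine measurable_of_tendsto_metrizable (f := fun (n : ℕ) (zx : S × Vec p) =>
    (n : ℝ) • (G zx.1 (zx.2 + (n : ℝ)⁻¹ • v) - G zx.1 zx.2)) (fun n => ?_)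
    (tendsto_pi_nhds.2 fun zx => ?_)
  · have h1 : Measurable fun zx : S × Vec p => G zx.1 (zx.2 + (n : ℝ)⁻¹ • v) :=
      hG.comp (measurable_fst.prodMk (measurable_snd.add_const _))
    simp only [smul_eq_mul]
    exact (h1.sub hG).const_mul _
  · refine (hd zx.1 zx.2).hasFDerivAt.lim v ?_
    simpa using tendsto_natCast_atTop_atTop (R := ℝ)

lemma gradient_apply {p : ℕ} (f : Vec p → ℝ) (x : Vec p) (i : Fin p) :
    gradient f x i = fderiv ℝ f x (EuclideanSpace.single i 1) := by
  rw [← inner_gradient_left, EuclideanSpace.inner_single_right]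
  simp

lemma norm_gradient_sub {p : ℕ} (f g : Vec p → ℝ) (x y : Vec p) :
    ‖gradient f x - gradient g y‖ = ‖fderiv ℝ f x - fderiv ℝ g y‖ := by
  rw [← toDual_gradient, ← toDual_gradient, ← map_sub, LinearIsometryEquiv.norm_map]

lemma stronglyMeasurable_clm_of_apply {p : ℕ} {S : Type*} [MeasurableSpace S]
    {F : S → Vec p →L[ℝ] ℝ} (h : ∀ v, Measurable fun z => F z v) : StronglyMeasurable F := by
  have hF : F = fun z => ∑ i, F z (EuclideanSpace.single i 1) •
      (EuclideanSpace.proj i : Vec p →L[ℝ] ℝ) := by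
    funext z
    ext v
    conv_lhs => rw [← (EuclideanSpace.basisFun (Fin p) ℝ).sum_repr v]
    simp [mul_comm]
  rw [hF]
  exact Finset.stronglyMeasurable_fun_sum _ fun i _ =>
    (h _).stronglyMeasurable.smul_const _

lemma integral_mat_apply {p : ℕ} {S : Type*} [MeasurableSpace S] {P : Measure S}
    {Λ : S → Mat p} (hΛ : Integrable Λ P) (i j : Fin p) :
    (∫ z, Λ z ∂P) i j = ∫ z, Λ z i j ∂P :=
  ((LinearMap.toContinuousLinearMap (Matrix.entryLinearMap ℝ ℝ i j)).integral_comp_comm hΛ).symm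

lemma integrable_mat_apply {p : ℕ} {S : Type*} [MeasurableSpace S] {P : Measure S}
    {Λ : S → Mat p} (hΛ : Integrable Λ P) (i j : Fin p) : Integrable (fun z => Λ z i j) P :=
  (LinearMap.toContinuousLinearMap (Matrix.entryLinearMap ℝ ℝ i j)).integrable_comp hΛ

/-! ### Regular sample functions and one expected step. -/

/-- The assumptions on the sample function that concern one observation, in the form they take
after a modification on a null set. -/
structure RegularSample {p : ℕ} {S : Type*} [MeasurableSpace S] (P : Measure S)
    (ℓ : S → Vec p → ℝ) (θs : Vec p) (β : S → ℝ) (M : ℝ) : Prop where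
  measurable : ∀ θ, Measurable fun z => ℓ z θ
  convex : ∀ z, ConvexOn ℝ Set.univ (ℓ z)
  integrable : ∀ θ, Integrable (fun z => ℓ z θ) P
  twice : ∀ z θ, TwiceDifferentiableAt (ℓ z) θ
  measurable_beta : Measurable β
  memLp_beta : MemLp β 2 P
  lipschitz : ∀ z θ, ‖gradient (ℓ z) θ - gradient (ℓ z) θs‖ ≤ β z * ‖θ - θs‖
  hessian_lipschitz : ∀ z θ, ‖hessian (ℓ z) θ - hessian (ℓ z) θs‖ ≤ M * ‖θ - θs‖
  memLp_gradient : MemLp (fun z => gradient (ℓ z) θs) 2 P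
  minimizer : IsMinOn (risk P ℓ) Set.univ θs
  twice_risk : TwiceDifferentiableAt (risk P ℓ) θs

namespace RegularSample

variable {p : ℕ} {S : Type*} [MeasurableSpace S] {P : Measure S} [IsProbabilityMeasure P]
  {ℓ : S → Vec p → ℝ} {θs : Vec p} {β : S → ℝ} {M : ℝ}

omit [IsProbabilityMeasure P] in
lemma differentiable (h : RegularSample P ℓ θs β M) (z : S) : Differentiable ℝ (ℓ z) :=
  fun θ => (h.twice z θ).1.self_of_nhds

omit [IsProbabilityMeasure P] in
lemma measurable_uncurry (h : RegularSample P ℓ θs β M) : Measurable (Function.uncurry ℓ) :=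
  measurable_uncurry_sample h.measurable fun z => (h.differentiable z).continuous

omit [IsProbabilityMeasure P] in
lemma measurable_fderiv_apply (h : RegularSample P ℓ θs β M) (v : Vec p) :
    Measurable fun zx : S × Vec p => fderiv ℝ (ℓ zx.1) zx.2 v :=
  measurable_fderiv_apply_of_measurable h.measurable_uncurry h.differentiable v

omit [IsProbabilityMeasure P] in
lemma measurable_gradient (h : RegularSample P ℓ θs β M) :
    Measurable fun zx : S × Vec p => gradient (ℓ zx.1) zx.2 := by
  have : (fun zx : S × Vec p => gradient (ℓ zx.1) zx.2) = fun zx => WithLp.toLp 2 fun i =>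
      fderiv ℝ (ℓ zx.1) zx.2 (EuclideanSpace.single i 1) := by
    funext zx
    ext i
    exact gradient_apply _ _ i
  rw [this]
  exact (WithLp.measurable_toLp 2 _).comp
    (measurable_pi_iff.2 fun i => h.measurable_fderiv_apply _)

omit [IsProbabilityMeasure P] in
lemma measurable_hessian_apply (h : RegularSample P ℓ θs β M) (i j : Fin p) :
    Measurable fun zx : S × Vec p => hessian (ℓ zx.1) zx.2 i j := by
  simp only [fun zx : S × Vec p => hessian_apply (h.twice zx.1 zx.2).2 i j]
  exact measurable_fderiv_apply_of_measurable
    (G := fun z x => fderiv ℝ (ℓ z) x (EuclideanSpace.single j 1)) (h.measurable_fderiv_apply _)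
    (fun z x => ((h.twice z x).2.clm_apply (differentiableAt_const _))) _

omit [IsProbabilityMeasure P] in
lemma norm_gradient_le (h : RegularSample P ℓ θs β M) (z : S) (θ : Vec p) :
    ‖gradient (ℓ z) θ‖ ≤ ‖gradient (ℓ z) θs‖ + β z * ‖θ - θs‖ := by
  have := norm_le_norm_add_norm_sub' (gradient (ℓ z) θ) (gradient (ℓ z) θs)
  linarith [h.lipschitz z θ]

omit [IsProbabilityMeasure P] in
lemma norm_gradient_sq_le (h : RegularSample P ℓ θs β M) (z : S) (θ : Vec p) :
    ‖gradient (ℓ z) θ‖ ^ 2 ≤ 2 * ‖gradient (ℓ z) θs‖ ^ 2 + 2 * (β z ^ 2 * ‖θ - θs‖ ^ 2) := by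
  have h1 := h.norm_gradient_le z θ
  have h2 := pow_le_pow_left₀ (norm_nonneg _) h1 2
  nlinarith [sq_nonneg (‖gradient (ℓ z) θs‖ - β z * ‖θ - θs‖)]

omit [IsProbabilityMeasure P] in
lemma measurable_gradient_at (h : RegularSample P ℓ θs β M) (θ : Vec p) :
    Measurable fun z => gradient (ℓ z) θ :=
  h.measurable_gradient.comp (measurable_id.prodMk measurable_const)

lemma integrable_norm_gradient_min (h : RegularSample P ℓ θs β M) :
    Integrable (fun z => ‖gradient (ℓ z) θs‖) P :=
  (h.memLp_gradient.integrable one_le_two).norm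

lemma integrable_beta (h : RegularSample P ℓ θs β M) : Integrable β P :=
  h.memLp_beta.integrable one_le_two

omit [IsProbabilityMeasure P] in
lemma integrable_beta_sq (h : RegularSample P ℓ θs β M) : Integrable (fun z => β z ^ 2) P :=
  h.memLp_beta.integrable_sq

omit [IsProbabilityMeasure P] in
lemma integrable_norm_gradient_sq (h : RegularSample P ℓ θs β M) :
    Integrable (fun z => ‖gradient (ℓ z) θs‖ ^ 2) P :=
  h.memLp_gradient.integrable_norm_pow two_ne_zero

omit [IsProbabilityMeasure P] in
-- Supplies the dominating function for differentiating the risk. The subgradient inequality bounds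
-- an increment by the gradient at an endpoint, and gradients are controlled by comparison with `θs`
-- alone.
lemma abs_sub_le (h : RegularSample P ℓ θs β M) (z : S) (x y : Vec p) :
    |ℓ z x - ℓ z y| ≤
      (‖gradient (ℓ z) θs‖ + |β z| * (‖x - θs‖ + ‖y - θs‖)) * ‖x - y‖ := by
  have key : ∀ x y : Vec p, ℓ z x - ℓ z y ≤
      (‖gradient (ℓ z) θs‖ + |β z| * (‖x - θs‖ + ‖y - θs‖)) * ‖x - y‖ := by
    intro x y
    have h1 := (h.convex z).isSubgradient_gradient (h.differentiable z x) y
    have h2 := abs_le.1 (abs_real_inner_le_norm (gradient (ℓ z) x) (y - x))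
    rw [norm_sub_rev y x] at h2
    have h3 : ‖gradient (ℓ z) x‖ ≤ ‖gradient (ℓ z) θs‖ + |β z| * (‖x - θs‖ + ‖y - θs‖) := by
      have a1 := h.norm_gradient_le z x
      have a2 : β z * ‖x - θs‖ ≤ |β z| * ‖x - θs‖ :=
        mul_le_mul_of_nonneg_right (le_abs_self _) (norm_nonneg _)
      have a3 : 0 ≤ |β z| * ‖y - θs‖ := by positivity
      rw [mul_add]
      linarith
    have h4 := mul_le_mul_of_nonneg_right h3 (norm_nonneg (x - y))
    linarith [h2.1]
  refine abs_le.2 ⟨?_, key x y⟩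
  have := key y x
  rw [norm_sub_rev y x, add_comm ‖y - θs‖] at this
  linarith

lemma hasFDerivAt_risk (h : RegularSample P ℓ θs β M) (θ : Vec p) :
    Integrable (fun z => fderiv ℝ (ℓ z) θ) P ∧
      HasFDerivAt (risk P ℓ) (∫ z, fderiv ℝ (ℓ z) θ ∂P) θ := by
  refine hasFDerivAt_integral_of_dominated_loc_of_lip' (s := Metric.ball θ 1)
    (bound := fun z => ‖gradient (ℓ z) θs‖ + |β z| * (2 * ‖θ - θs‖ + 1))
    (Metric.ball_mem_nhds _ one_pos) (fun x _ => (h.measurable x).aestronglyMeasurable)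
    (h.integrable θ) ?_ ?_ ?_ ?_
  · exact (stronglyMeasurable_clm_of_apply fun v =>
      (h.measurable_fderiv_apply v).comp (measurable_id.prodMk measurable_const)).aestronglyMeasurable
  · refine Eventually.of_forall fun z x hx => (h.abs_sub_le z x θ).trans ?_
    refine mul_le_mul_of_nonneg_right ?_ (norm_nonneg _)
    rw [Metric.mem_ball, dist_eq_norm] at hx
    have h1 : ‖x - θs‖ ≤ ‖x - θ‖ + ‖θ - θs‖ := norm_sub_le_norm_sub_add_norm_sub _ _ _
    have : ‖x - θs‖ + ‖θ - θs‖ ≤ 2 * ‖θ - θs‖ + 1 := by linarith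
    gcongr
  · exact h.integrable_norm_gradient_min.add (h.integrable_beta.abs.mul_const _)
  · exact Eventually.of_forall fun z => (h.differentiable z θ).hasFDerivAt

lemma fderiv_risk_apply (h : RegularSample P ℓ θs β M) (θ v : Vec p) :
    fderiv ℝ (risk P ℓ) θ v = ∫ z, fderiv ℝ (ℓ z) θ v ∂P := by
  rw [(h.hasFDerivAt_risk θ).2.fderiv, ContinuousLinearMap.integral_apply (h.hasFDerivAt_risk θ).1]

omit [IsProbabilityMeasure P] in
lemma fderiv_risk_min (h : RegularSample P ℓ θs β M) : fderiv ℝ (risk P ℓ) θs = 0 :=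
  (h.minimizer.isLocalMin univ_mem).fderiv_eq_zero

omit [IsProbabilityMeasure P] in
lemma gradient_risk_min (h : RegularSample P ℓ θs β M) : gradient (risk P ℓ) θs = 0 := by
  rw [gradient, h.fderiv_risk_min, map_zero]

lemma integral_inner_gradient_min (h : RegularSample P ℓ θs β M) (v : Vec p) :
    ∫ z, inner ℝ (gradient (ℓ z) θs) v ∂P = 0 := by
  simp only [inner_gradient_left]
  rw [← h.fderiv_risk_apply, h.fderiv_risk_min]
  rfl

/-- The Hessian of the risk at its minimizer is the expected sample Hessian. -/
lemma hessian_risk_apply (h : RegularSample P ℓ θs β M) (i j : Fin p) :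
    hessian (risk P ℓ) θs i j = ∫ z, hessian (ℓ z) θs i j ∂P := by
  set e : Fin p → Vec p := fun k => EuclideanSpace.single k 1 with he
  have hd : ∀ z θ, DifferentiableAt ℝ (fun x => fderiv ℝ (ℓ z) x (e j)) θ := fun z θ =>
    (h.twice z θ).2.clm_apply (differentiableAt_const _)
  have hm : Measurable fun zx : S × Vec p => fderiv ℝ (ℓ zx.1) zx.2 (e j) :=
    h.measurable_fderiv_apply _
  -- This form of differentiation under the integral asks for increments from the base point only,
  -- which is what smoothness around `θs` gives, with dominating function `β`.
  have key := hasFDerivAt_integral_of_dominated_loc_of_lip' (μ := P) (𝕜 := ℝ) (s := Set.univ)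
    (F := fun θ z => fderiv ℝ (ℓ z) θ (e j)) (x₀ := θs) (bound := β)
    (F' := fun z => fderiv ℝ (fun θ => fderiv ℝ (ℓ z) θ (e j)) θs) univ_mem
    (fun x _ => (hm.comp (measurable_id.prodMk measurable_const)).aestronglyMeasurable)
    ((h.hasFDerivAt_risk θs).1.apply_continuousLinearMap _)
    (stronglyMeasurable_clm_of_apply fun v => (measurable_fderiv_apply_of_measurable
      (G := fun z θ => fderiv ℝ (ℓ z) θ (e j)) hm hd v).comp
        (measurable_id.prodMk measurable_const)).aestronglyMeasurable
    (Eventually.of_forall fun z x _ => by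
      rw [← sub_apply]
      refine (ContinuousLinearMap.le_opNorm _ _).trans ?_
      rw [← norm_gradient_sub, he]
      simpa using h.lipschitz z x)
    h.integrable_beta
    (Eventually.of_forall fun z => (hd z θs).hasFDerivAt)
  rw [hessian_apply h.twice_risk.2]
  simp only [h.fderiv_risk_apply]
  rw [key.2.fderiv, ContinuousLinearMap.integral_apply key.1]
  exact integral_congr_ae (Eventually.of_forall fun z => (hessian_apply (h.twice z θs).2 i j).symm)

/-- Quadratic growth of the risk. -/
lemma quadratic_growth (h : RegularSample P ℓ θs β M) {Λ : S → Mat p}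
    (hint : Integrable Λ P) (hconv : ∀ᵐ z ∂P, MConvexAt (ℓ z) (Λ z) θs)
    {a : ℝ} (ha : GeScalar a (∫ z, Λ z ∂P)) (θ : Vec p) :
    a / 2 * ‖θ - θs‖ ^ 2 ≤ risk P ℓ θ - risk P ℓ θs := by
  set e := θ - θs with he
  have h1 : ∀ᵐ z ∂P, (1 / 2) * ∑ i, ∑ j, e i * Λ z i j * e j ≤
      ℓ z θ - ℓ z θs - inner ℝ (gradient (ℓ z) θs) e := by
    filter_upwards [hconv] with z hz
    have := hz _ ((h.convex z).isSubgradient_gradient (h.differentiable z θs)) θ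
    rw [← he] at this
    linarith
  have hi : ∀ i j, Integrable (fun z => e i * Λ z i j * e j) P := fun i j =>
    ((integrable_mat_apply hint i j).const_mul _).mul_const _
  have hinner : Integrable (fun z => inner ℝ (gradient (ℓ z) θs) e) P :=
    (h.memLp_gradient.integrable one_le_two).inner_const e
  have h2 := integral_mono_ae
    ((integrable_finsetSum _ fun i _ => integrable_finsetSum _ fun j _ => hi i j).const_mul (1 / 2))
    (((h.integrable θ).sub (h.integrable θs)).sub hinner) h1
  rw [integral_const_mul, integral_finsetSum _ fun i _ => integrable_finsetSum _ fun j _ => hi i j,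
    -- The linear term integrates to zero by the first-order condition at `θs`.
    integral_sub' ((h.integrable θ).sub (h.integrable θs)) hinner,
    integral_sub' (h.integrable θ) (h.integrable θs), h.integral_inner_gradient_min] at h2
  have h3 : ∀ i, ∫ z, ∑ j, e i * Λ z i j * e j ∂P = ∑ j, e i * (∫ z, Λ z ∂P) i j * e j := by
    intro i
    rw [integral_finsetSum _ fun j _ => hi i j]
    refine Finset.sum_congr rfl fun j _ => ?_
    rw [integral_mul_const, integral_const_mul, integral_mat_apply hint]
  simp only [h3] at h2
  have h4 := ha.le_dotProduct (fun i => e i)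
  have h5 : ‖e‖ ^ 2 = (fun i => e i) ⬝ᵥ fun i => e i := by
    rw [EuclideanSpace.norm_sq_eq]
    simp [dotProduct, sq]
  have h6 : (fun i => e i) ⬝ᵥ ((∫ z, Λ z ∂P).mulVec fun i => e i) =
      ∑ i, ∑ j, e i * (∫ z, Λ z ∂P) i j * e j := by
    simp only [dotProduct, Matrix.mulVec, Finset.mul_sum, mul_assoc]
  rw [h6] at h4
  rw [h5]
  simp only [risk]
  linarith

/-- One step of the proximal iteration, in expectation. -/
lemma lintegral_prox_le (h : RegularSample P ℓ θs β M) {a : ℝ}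
    (ha : ∀ θ, a / 2 * ‖θ - θs‖ ^ 2 ≤ risk P ℓ θ - risk P ℓ θs) {c : ℝ} (hc : 0 < c) (θ : Vec p) :
    ∫⁻ z, ENNReal.ofReal (‖prox c (ℓ z) θ - θs‖ ^ 2) ∂P ≤
      ENNReal.ofReal ((1 - c * a + (2 * ∫ z, β z ^ 2 ∂P) * c ^ 2) * ‖θ - θs‖ ^ 2 +
        (2 * ∫ z, ‖gradient (ℓ z) θs‖ ^ 2 ∂P) * c ^ 2) := by
  set R : S → ℝ := fun z => ‖θ - θs‖ ^ 2 - 2 * c * (ℓ z θ - ℓ z θs) +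
    c ^ 2 * (2 * ‖gradient (ℓ z) θs‖ ^ 2 + 2 * (β z ^ 2 * ‖θ - θs‖ ^ 2)) with hR
  have hle : ∀ z, ‖prox c (ℓ z) θ - θs‖ ^ 2 ≤ R z := fun z => by
    have h1 := norm_prox_sub_sq_le hc (h.convex z) (h.differentiable z) θ θs
    have h2 := mul_le_mul_of_nonneg_left (h.norm_gradient_sq_le z θ) (sq_nonneg c)
    simp only [hR]
    linarith
  have i1 : Integrable (fun z => 2 * c * (ℓ z θ - ℓ z θs)) P :=
    ((h.integrable θ).sub (h.integrable θs)).const_mul _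
  have i2 : Integrable (fun z => 2 * ‖gradient (ℓ z) θs‖ ^ 2) P :=
    h.integrable_norm_gradient_sq.const_mul _
  have i3 : Integrable (fun z => 2 * (β z ^ 2 * ‖θ - θs‖ ^ 2)) P :=
    (h.integrable_beta_sq.mul_const _).const_mul _
  have i4 : Integrable (fun z => c ^ 2 * (2 * ‖gradient (ℓ z) θs‖ ^ 2 +
    2 * (β z ^ 2 * ‖θ - θs‖ ^ 2))) P := (i2.add i3).const_mul _
  have i5 : Integrable (fun z => ‖θ - θs‖ ^ 2 - 2 * c * (ℓ z θ - ℓ z θs)) P :=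
    (integrable_const _).sub i1
  have hRi : Integrable R P := i5.add i4
  calc ∫⁻ z, ENNReal.ofReal (‖prox c (ℓ z) θ - θs‖ ^ 2) ∂P
      ≤ ∫⁻ z, ENNReal.ofReal (R z) ∂P := lintegral_mono fun z => ENNReal.ofReal_le_ofReal (hle z)
    _ = ENNReal.ofReal (∫ z, R z ∂P) :=
        (ofReal_integral_eq_lintegral_ofReal hRi
          (Eventually.of_forall fun z => (sq_nonneg _).trans (hle z))).symm
    _ ≤ _ := by
        refine ENNReal.ofReal_le_ofReal ?_
        have h0 : ∫ z, R z ∂P = ‖θ - θs‖ ^ 2 - 2 * c * (risk P ℓ θ - risk P ℓ θs) +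
            c ^ 2 * (2 * ∫ z, ‖gradient (ℓ z) θs‖ ^ 2 ∂P + 2 * ((∫ z, β z ^ 2 ∂P) * ‖θ - θs‖ ^ 2)) := by
          simp only [hR]
          rw [integral_add i5 i4, integral_sub (integrable_const _) i1, integral_const_mul,
            integral_const_mul, integral_sub (h.integrable θ) (h.integrable θs),
            integral_add i2 i3, integral_const_mul, integral_const_mul, integral_mul_const]
          simp [risk]
        rw [h0]
        have := mul_le_mul_of_nonneg_left (ha θ) (by positivity : 0 ≤ 2 * c)
        linarith

end RegularSample

/-! ### Deterministic rates -/

/-- A Chung-type lemma for step sizes `c (n+1)^{-γ}`. -/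
lemma exists_le_mul_rpow_of_recursion {b : ℕ → ℝ} {c a B C γ : ℝ} (hc : 0 < c) (ha : 0 < a)
    (hB : a ^ 2 ≤ 4 * B) (hC : 0 ≤ C) (hγ : (γ = 1 ∧ 2 ≤ a * c) ∨ (1 / 2 < γ ∧ γ < 1))
    (hrec : ∀ n : ℕ, b (n + 1) ≤ (1 - c * ((n : ℝ) + 1) ^ (-γ) * a +
      B * (c * ((n : ℝ) + 1) ^ (-γ)) ^ 2) * b n + C * (c * ((n : ℝ) + 1) ^ (-γ)) ^ 2) :
    ∃ K : ℝ, 0 < K ∧ ∀ n : ℕ, b n ≤ K * ((n : ℝ) + 1) ^ (-γ) := by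
  set g : ℕ → ℝ := fun n => ((n : ℝ) + 1) ^ (-γ) with hg
  have hγ0 : 0 < γ := by rcases hγ with h | h <;> linarith [h.1]
  have hγ1 : γ ≤ 1 := by rcases hγ with h | h <;> [exact h.1.le; exact h.2.le]
  have hgpos : ∀ n, 0 < g n := fun n => Real.rpow_pos_of_pos (by positivity) _
  have hcast : Tendsto (fun n : ℕ => (n : ℝ) + 1) atTop atTop :=
    tendsto_atTop_add_const_right _ _ tendsto_natCast_atTop_atTop
  have hg0 : Tendsto g atTop (𝓝 0) := (tendsto_rpow_neg_atTop hγ0).comp hcast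
  have hB0 : 0 < B := by nlinarith [sq_pos_of_pos ha]
  -- The contraction gains `a c g_n²` times `K`: a quarter pays for the `B` term, a quarter for the
  -- `C` term, and half for the decrease of `g`, at most `g_n / (n + 2)`. For `γ = 1` the last
  -- payment is where `2 ≤ a * c` is needed.
  have hev : ∀ᶠ n in atTop, B * c ^ 2 * g n ≤ a * c / 4 ∧ 1 ≤ ((n : ℝ) + 2) * g n * (a * c / 2) := by
    refine Eventually.and ?_ ?_
    · have : Tendsto (fun n => B * c ^ 2 * g n) atTop (𝓝 0) := by simpa using hg0.const_mul (B * c ^ 2)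
      exact this.eventually_le_const (by positivity)
    · have hlow : ∀ n : ℕ, ((n : ℝ) + 1) ^ (1 - γ) ≤ ((n : ℝ) + 2) * g n := fun n => by
        rw [sub_eq_add_neg, Real.rpow_add (by positivity), Real.rpow_one]
        exact mul_le_mul_of_nonneg_right (by linarith) (hgpos n).le
      rcases hγ with ⟨h1, h2⟩ | ⟨-, h1⟩
      · refine Eventually.of_forall fun n => ?_
        have := hlow n
        rw [h1, sub_self, Real.rpow_zero] at this
        nlinarith
      · have ht : Tendsto (fun n : ℕ => ((n : ℝ) + 1) ^ (1 - γ)) atTop atTop :=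
          (tendsto_rpow_atTop (by linarith)).comp hcast
        filter_upwards [ht.eventually_ge_atTop (2 / (a * c))] with n hn
        have h3 := hn.trans (hlow n)
        rw [div_le_iff₀ (by positivity)] at h3
        linarith
  obtain ⟨N, hN⟩ := eventually_atTop.1 hev
  -- The sum covers the indices up to `N`; the middle term makes `C c² ≤ K a c / 4`.
  set K : ℝ := 1 + 4 * C * c / a + ∑ k ∈ Finset.range (N + 1), |b k| / g k with hK
  have hs0 : 0 ≤ ∑ k ∈ Finset.range (N + 1), |b k| / g k :=
    Finset.sum_nonneg fun k _ => div_nonneg (abs_nonneg _) (hgpos k).le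
  have hq0 : 0 ≤ 4 * C * c / a := by positivity
  have hKpos : 0 < K := by linarith
  have hCK : C * c ^ 2 ≤ K * (a * c / 4) := by
    have : 4 * C * c / a ≤ K := by linarith
    rw [div_le_iff₀ ha] at this
    nlinarith
  refine ⟨K, hKpos, fun n => ?_⟩
  rcases le_total n N with hn | hn
  · have h1 : |b n| / g n ≤ ∑ k ∈ Finset.range (N + 1), |b k| / g k :=
      Finset.single_le_sum (f := fun k => |b k| / g k)
        (fun k _ => div_nonneg (abs_nonneg _) (hgpos k).le) (Finset.mem_range.2 (by omega))
    have h2 : |b n| / g n ≤ K := by linarith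
    rw [div_le_iff₀ (hgpos n)] at h2
    exact (le_abs_self _).trans h2
  · induction n, hn using Nat.le_induction with
    | base =>
      have h1 : |b N| / g N ≤ ∑ k ∈ Finset.range (N + 1), |b k| / g k :=
        Finset.single_le_sum (f := fun k => |b k| / g k)
          (fun k _ => div_nonneg (abs_nonneg _) (hgpos k).le) (Finset.mem_range.2 (by omega))
      have h2 : |b N| / g N ≤ K := by linarith
      rw [div_le_iff₀ (hgpos N)] at h2
      exact (le_abs_self _).trans h2
    | succ n hn ih =>
      obtain ⟨e1, e2⟩ := hN n hn
      have hg' : ((n : ℝ) + 1) ^ (-γ) = g n := rfl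
      have hr := hrec n
      rw [hg'] at hr ih
      have hcoef : 0 ≤ 1 - c * g n * a + B * (c * g n) ^ 2 := by
        nlinarith [sq_nonneg (1 - c * g n * a / 2), sq_nonneg (c * g n)]
      have hratio : g n - g (n + 1) ≤ g n / ((n : ℝ) + 2) := by
        -- The exact ratio is `((n+1)/(n+2))^γ`, and a base in `(0, 1]` with `γ ≤ 1` only increases.
        have h2 : ((n : ℝ) + 1) / ((n : ℝ) + 2) * g n ≤ g (n + 1) := by
          have hx0 : 0 < ((n : ℝ) + 1) / ((n : ℝ) + 2) := by positivity
          have hx1 : ((n : ℝ) + 1) / ((n : ℝ) + 2) ≤ 1 := by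
            rw [div_le_one (by positivity)]; linarith
          have h3 : ((n : ℝ) + 1) / ((n : ℝ) + 2) ≤ (((n : ℝ) + 1) / ((n : ℝ) + 2)) ^ γ := by
            simpa using Real.rpow_le_rpow_of_exponent_ge hx0 hx1 hγ1
          have h4 : (((n : ℝ) + 1) / ((n : ℝ) + 2)) ^ γ * g n = g (n + 1) := by
            simp only [hg]
            rw [Real.div_rpow (by positivity) (by positivity), Real.rpow_neg (by positivity),
              Real.rpow_neg (by positivity)]
            have e : ((n + 1 : ℕ) : ℝ) + 1 = (n : ℝ) + 2 := by push_cast; ring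
            rw [e]
            have := (Real.rpow_pos_of_pos (by positivity : (0 : ℝ) < (n : ℝ) + 1) γ).ne'
            field_simp
          rw [← h4]
          exact mul_le_mul_of_nonneg_right h3 (hgpos n).le
        have h5 : g n - ((n : ℝ) + 1) / ((n : ℝ) + 2) * g n = g n / ((n : ℝ) + 2) := by
          field_simp; ring
        linarith
      have h6 : g n / ((n : ℝ) + 2) ≤ g n ^ 2 * (a * c / 2) := by
        rw [div_le_iff₀ (by positivity)]
        nlinarith [mul_le_mul_of_nonneg_left e2 (hgpos n).le]
      have h7 : B * c ^ 2 * g n ^ 3 ≤ a * c / 4 * g n ^ 2 := by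
        have := mul_le_mul_of_nonneg_right e1 (sq_nonneg (g n))
        nlinarith
      have h8 := mul_le_mul_of_nonneg_left ih hcoef
      have h9 : C * c ^ 2 * g n ^ 2 ≤ K * (a * c / 4) * g n ^ 2 :=
        mul_le_mul_of_nonneg_right hCK (sq_nonneg _)
      have h10 : K * (g n - g (n + 1)) ≤ K * (g n ^ 2 * (a * c / 2)) :=
        mul_le_mul_of_nonneg_left (hratio.trans h6) hKpos.le
      have h11 := mul_le_mul_of_nonneg_left h7 hKpos.le
      have hgoal : b (n + 1) ≤ K * g (n + 1) := by nlinarith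
      exact hgoal

/-- Comparison with the integral of `x^{-s}`; the inductive step is Bernoulli's inequality for the
exponent `1 - s ≤ 1` at `-1/(n+1)`. -/
lemma sum_rpow_neg_le {s : ℝ} (hs0 : 0 ≤ s) (hs1 : s < 1) (n : ℕ) :
    ∑ k ∈ Finset.range n, ((k : ℝ) + 1) ^ (-s) ≤ (n : ℝ) ^ (1 - s) / (1 - s) := by
  induction n with
  | zero => simp [Real.zero_rpow (by linarith : 1 - s ≠ 0)]
  | succ n ih =>
    rw [Finset.sum_range_succ]
    have hx : (0 : ℝ) < (n : ℝ) + 1 := by positivity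
    have h1 : ((n : ℝ) / ((n : ℝ) + 1)) ^ (1 - s) ≤ 1 - (1 - s) / ((n : ℝ) + 1) := by
      have := _root_.rpow_one_add_le_one_add_mul_self (s := -(1 / ((n : ℝ) + 1)))
        (by rw [neg_le_neg_iff, div_le_one hx]; linarith) (p := 1 - s) (by linarith) (by linarith)
      have e : 1 + -(1 / ((n : ℝ) + 1)) = (n : ℝ) / ((n : ℝ) + 1) := by field_simp; ring
      rw [e] at this
      calc _ ≤ _ := this
        _ = _ := by ring
    rw [Real.div_rpow (by positivity) hx.le, div_le_iff₀ (Real.rpow_pos_of_pos hx _)] at h1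
    have h2 : ((n : ℝ) + 1) ^ (1 - s) = ((n : ℝ) + 1) * ((n : ℝ) + 1) ^ (-s) := by
      rw [sub_eq_add_neg, Real.rpow_add hx, Real.rpow_one]
    have h3 : (1 - (1 - s) / ((n : ℝ) + 1)) * ((n : ℝ) + 1) ^ (1 - s) =
        ((n : ℝ) + 1) ^ (1 - s) - (1 - s) * ((n : ℝ) + 1) ^ (-s) := by
      rw [h2]; field_simp
    rw [h3] at h1
    have hs : 0 < 1 - s := by linarith
    rw [le_div_iff₀ hs] at ih ⊢
    push_cast
    linarith

/-! ### The iterates -/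

section Iterates

variable {p : ℕ} {S : Type*} [MeasurableSpace S] {P : Measure S} [IsProbabilityMeasure P]
  {Ω : Type*} [MeasurableSpace Ω] {μ : Measure Ω} [IsProbabilityMeasure μ] {Z : ℕ → Ω → S}
  {ℓ : S → Vec p → ℝ} {θs θ₀ : Vec p} {γ₁ γ : ℝ} {β : S → ℝ} {M : ℝ}

lemma stepSize_succ_pos (hγ₁ : 0 < γ₁) (n : ℕ) : 0 < stepSize γ₁ γ (n + 1) :=
  mul_pos hγ₁ (Real.rpow_pos_of_pos (by positivity) _)

lemma stepSize_succ (n : ℕ) : stepSize γ₁ γ (n + 1) = γ₁ * ((n : ℝ) + 1) ^ (-γ) := by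
  simp [stepSize]

omit [MeasurableSpace Ω] in
lemma pastSigma_mono : Monotone (pastSigma (S := S) Z) := fun _ _ hmn =>
  biSup_mono fun _ hk => Finset.mem_range.2 ((Finset.mem_range.1 hk).trans_le hmn)

lemma pastSigma_le (hZ : ∀ n, Measurable (Z n)) (n : ℕ) : pastSigma Z n ≤ ‹MeasurableSpace Ω› :=
  iSup₂_le fun k _ => (hZ k).comap_le

omit [IsProbabilityMeasure P] [MeasurableSpace Ω] in
/-- The iterates are adapted to the past. -/
lemma measurable_proxRM_pastSigma (h : RegularSample P ℓ θs β M) (hγ₁ : 0 < γ₁) (n : ℕ) :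
    Measurable[pastSigma Z n] fun ω => proxRM ℓ γ₁ γ θ₀ (fun k => Z k ω) n := by
  induction n with
  | zero => exact @measurable_const _ _ _ (pastSigma Z 0) _
  | succ n ih =>
    have h1 : Measurable[pastSigma Z (n + 1)] (Z n) :=
      (comap_measurable (Z n)).mono
        (le_iSup₂_of_le n (Finset.mem_range.2 n.lt_succ_self) le_rfl) le_rfl
    have h2 := ih.mono (pastSigma_mono n.le_succ) le_rfl
    exact (measurable_prox (stepSize_succ_pos (γ := γ) hγ₁ n) h.measurable h.convex
      h.differentiable).comp (Measurable.prodMk h1 h2)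

omit [IsProbabilityMeasure P] in
lemma measurable_proxRM (h : RegularSample P ℓ θs β M) (hγ₁ : 0 < γ₁)
    (hZ : ∀ n, Measurable (Z n)) (n : ℕ) :
    Measurable fun ω => proxRM ℓ γ₁ γ θ₀ (fun k => Z k ω) n :=
  (measurable_proxRM_pastSigma h hγ₁ n).mono (pastSigma_le hZ n) le_rfl

omit [IsProbabilityMeasure P] [IsProbabilityMeasure μ] in
/-- An observation is independent of the iterate that precedes it. -/
lemma indepFun_proxRM (h : RegularSample P ℓ θs β M) (hγ₁ : 0 < γ₁)
    (hZ : ∀ n, Measurable (Z n)) (hind : iIndepFun Z μ) (n : ℕ) :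
    IndepFun (Z n) (fun ω => proxRM ℓ γ₁ γ θ₀ (fun k => Z k ω) n) μ := by
  -- With data indexed from `0`, the iterate of index `n` uses the observations `0, …, n - 1` only.
  have h1 := indep_iSup_of_disjoint (fun k => (hZ k).comap_le) hind.iIndep
    (S := {n}) (T := (Finset.range n : Set ℕ)) (by simp)
  rw [IndepFun_iff_Indep]
  refine indep_of_indep_of_le_left (indep_of_indep_of_le_right h1
    (measurable_proxRM_pastSigma h hγ₁ n).comap_le) ?_
  exact le_iSup₂_of_le n rfl le_rfl

/-- By independence the pair has a product law, so the iterate can be frozen while the observation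
is integrated out. This plays the role of conditioning on the past. -/
lemma lintegral_observation_proxRM (h : RegularSample P ℓ θs β M) (hγ₁ : 0 < γ₁)
    (hZ : ∀ n, Measurable (Z n)) (hind : iIndepFun Z μ) (hlaw : ∀ n, μ.map (Z n) = P) (n : ℕ)
    {f : S × Vec p → ENNReal} (hf : Measurable f) :
    ∫⁻ ω, f (Z n ω, proxRM ℓ γ₁ γ θ₀ (fun k => Z k ω) n) ∂μ =
      ∫⁻ ω, ∫⁻ z, f (z, proxRM ℓ γ₁ γ θ₀ (fun k => Z k ω) n) ∂P ∂μ := by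
  have hm := measurable_proxRM (θ₀ := θ₀) (γ := γ) h hγ₁ hZ n
  have hmap := (indepFun_iff_map_prod_eq_prod_map_map (hZ n).aemeasurable hm.aemeasurable).1
    (indepFun_proxRM (θ₀ := θ₀) (γ := γ) h hγ₁ hZ hind n)
  have := Measure.isProbabilityMeasure_map (μ := μ) hm.aemeasurable
  rw [← lintegral_map hf ((hZ n).prodMk hm), hmap, hlaw, lintegral_prod_symm' _ hf,
    lintegral_map hf.lintegral_prod_left' hm]

/-- The mean square error of the iterates. -/
lemma exists_lintegral_proxRM_le (h : RegularSample P ℓ θs β M) (hγ₁ : 0 < γ₁)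
    (hZ : ∀ n, Measurable (Z n)) (hind : iIndepFun Z μ) (hlaw : ∀ n, μ.map (Z n) = P)
    {a : ℝ} (ha0 : 0 < a) (ha : ∀ θ, a / 2 * ‖θ - θs‖ ^ 2 ≤ risk P ℓ θ - risk P ℓ θs)
    (hγ : (γ = 1 ∧ 2 ≤ a * γ₁) ∨ (1 / 2 < γ ∧ γ < 1)) :
    ∃ K : ℝ, 0 < K ∧ ∀ n : ℕ,
      ∫⁻ ω, ENNReal.ofReal (‖proxRM ℓ γ₁ γ θ₀ (fun k => Z k ω) n - θs‖ ^ 2) ∂μ ≤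
        ENNReal.ofReal (K * ((n : ℝ) + 1) ^ (-γ)) := by
  -- The extra `a² / 4` makes `1 - c a + B c² ≥ (1 - c a / 2)² ≥ 0` for every `c`, so the recursion
  -- is monotone in the previous error.
  set B : ℝ := 2 * ∫ z, β z ^ 2 ∂P + a ^ 2 / 4 with hB
  set C : ℝ := 2 * ∫ z, ‖gradient (ℓ z) θs‖ ^ 2 ∂P with hC
  have hβ0 : 0 ≤ ∫ z, β z ^ 2 ∂P := integral_nonneg fun z => sq_nonneg _
  have hC0 : 0 ≤ C := mul_nonneg zero_le_two (integral_nonneg fun z => sq_nonneg _)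
  have haB : a ^ 2 ≤ 4 * B := by rw [hB]; linarith
  -- The recursion solved with equality: a real majorant of the mean square errors, which are kept
  -- as `lintegral`s so that finiteness comes out of the induction.
  set b : ℕ → ℝ := fun n => Nat.rec (‖θ₀ - θs‖ ^ 2) (fun n x =>
    (1 - stepSize γ₁ γ (n + 1) * a + B * stepSize γ₁ γ (n + 1) ^ 2) * x +
      C * stepSize γ₁ γ (n + 1) ^ 2) n with hb
  have hb1 : ∀ n, b (n + 1) = (1 - stepSize γ₁ γ (n + 1) * a + B * stepSize γ₁ γ (n + 1) ^ 2) *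
      b n + C * stepSize γ₁ γ (n + 1) ^ 2 := fun n => rfl
  obtain ⟨K, hK, hbK⟩ := exists_le_mul_rpow_of_recursion (b := b) (γ := γ) hγ₁ ha0 haB hC0 hγ
    fun n => by rw [hb1, stepSize_succ]
  refine ⟨K, hK, fun n => le_trans ?_ (ENNReal.ofReal_le_ofReal (hbK n))⟩
  clear hbK
  have hcoef : ∀ c : ℝ, 0 ≤ 1 - c * a + B * c ^ 2 := fun c => by
    nlinarith [sq_nonneg (1 - c * a / 2), sq_nonneg c]
  have hb0 : ∀ n, 0 ≤ b n := fun n => by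
    induction n with
    | zero => exact sq_nonneg _
    | succ n ih =>
      rw [hb1]
      exact add_nonneg (mul_nonneg (hcoef _) ih) (mul_nonneg hC0 (sq_nonneg _))
  induction n with
  | zero => simp [proxRM, hb]
  | succ n ih =>
    set c := stepSize γ₁ γ (n + 1) with hc
    have hcpos : 0 < c := stepSize_succ_pos hγ₁ n
    have hmp := measurable_prox hcpos h.measurable h.convex h.differentiable
    have hm := measurable_proxRM (θ₀ := θ₀) (γ := γ) h hγ₁ hZ n
    have e1 := lintegral_observation_proxRM (θ₀ := θ₀) (γ := γ) h hγ₁ hZ hind hlaw n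
      (f := fun zx => ENNReal.ofReal (‖prox c (ℓ zx.1) zx.2 - θs‖ ^ 2))
      (((hmp.sub_const _).norm.pow_const 2).ennreal_ofReal)
    calc ∫⁻ ω, ENNReal.ofReal (‖proxRM ℓ γ₁ γ θ₀ (fun k => Z k ω) (n + 1) - θs‖ ^ 2) ∂μ
        = _ := e1
      _ ≤ ∫⁻ ω, (ENNReal.ofReal (1 - c * a + B * c ^ 2) *
            ENNReal.ofReal (‖proxRM ℓ γ₁ γ θ₀ (fun k => Z k ω) n - θs‖ ^ 2) +
            ENNReal.ofReal (C * c ^ 2)) ∂μ := by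
          refine lintegral_mono fun ω => (h.lintegral_prox_le ha hcpos _).trans ?_
          rw [← ENNReal.ofReal_mul (hcoef c), ← ENNReal.ofReal_add
            (mul_nonneg (hcoef c) (sq_nonneg _)) (mul_nonneg hC0 (sq_nonneg _))]
          refine ENNReal.ofReal_le_ofReal (add_le_add_left (mul_le_mul_of_nonneg_right ?_
            (sq_nonneg _)) _)
          have : 0 ≤ a ^ 2 / 4 * c ^ 2 := by positivity
          rw [hB]
          linarith
      _ = ENNReal.ofReal (1 - c * a + B * c ^ 2) *
            ∫⁻ ω, ENNReal.ofReal (‖proxRM ℓ γ₁ γ θ₀ (fun k => Z k ω) n - θs‖ ^ 2) ∂μ +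
            ENNReal.ofReal (C * c ^ 2) := by
          rw [lintegral_add_right _ measurable_const, lintegral_const_mul]
          · simp
          · exact ((hm.sub_const _).norm.pow_const 2).ennreal_ofReal
      _ ≤ ENNReal.ofReal (1 - c * a + B * c ^ 2) * ENNReal.ofReal (b n) +
            ENNReal.ofReal (C * c ^ 2) := by gcongr
      _ = ENNReal.ofReal (b (n + 1)) := by
          rw [hb1, ← ENNReal.ofReal_mul (hcoef c), ← ENNReal.ofReal_add
            (mul_nonneg (hcoef c) (hb0 n)) (mul_nonneg hC0 (sq_nonneg _))]

end Iterates

/-! ### Rates in mean -/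

/-- `E|f_n| = O(n^{-s})`. -/
def L1Rate {Ω : Type*} [MeasurableSpace Ω] (μ : Measure Ω) (s : ℝ) (f : ℕ → Ω → ℝ) : Prop :=
  ∃ C : ℝ, 0 ≤ C ∧ ∀ n : ℕ, 1 ≤ n → Integrable (f n) μ ∧ ∫ ω, |f n ω| ∂μ ≤ C * (n : ℝ) ^ (-s)

section Rates

variable {Ω : Type*} [MeasurableSpace Ω] {μ : Measure Ω} {s : ℝ}

lemma L1Rate.add {f g : ℕ → Ω → ℝ} (hf : L1Rate μ s f) (hg : L1Rate μ s g) :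
    L1Rate μ s fun n ω => f n ω + g n ω := by
  obtain ⟨C, hC, h1⟩ := hf
  obtain ⟨D, hD, h2⟩ := hg
  refine ⟨C + D, by positivity, fun n hn => ⟨(h1 n hn).1.add (h2 n hn).1, ?_⟩⟩
  calc ∫ ω, |f n ω + g n ω| ∂μ ≤ ∫ ω, (|f n ω| + |g n ω|) ∂μ :=
        integral_mono ((h1 n hn).1.add (h2 n hn).1).abs ((h1 n hn).1.abs.add (h2 n hn).1.abs)
          fun ω => abs_add_le _ _
    _ = ∫ ω, |f n ω| ∂μ + ∫ ω, |g n ω| ∂μ := integral_add (h1 n hn).1.abs (h2 n hn).1.abs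
    _ ≤ _ := by rw [add_mul]; exact add_le_add (h1 n hn).2 (h2 n hn).2

lemma L1Rate.const_mul {f : ℕ → Ω → ℝ} (hf : L1Rate μ s f) (c : ℝ) :
    L1Rate μ s fun n ω => c * f n ω := by
  obtain ⟨C, hC, h⟩ := hf
  refine ⟨|c| * C, by positivity, fun n hn => ⟨(h n hn).1.const_mul c, ?_⟩⟩
  simp only [abs_mul, integral_const_mul]
  rw [mul_assoc]
  exact mul_le_mul_of_nonneg_left (h n hn).2 (abs_nonneg c)

lemma L1Rate.abs {f : ℕ → Ω → ℝ} (hf : L1Rate μ s f) : L1Rate μ s fun n ω => |f n ω| := by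
  obtain ⟨C, hC, h⟩ := hf
  exact ⟨C, hC, fun n hn => ⟨(h n hn).1.abs, by simpa only [abs_abs] using (h n hn).2⟩⟩

lemma L1Rate.sum {ι : Type*} (t : Finset ι) {f : ι → ℕ → Ω → ℝ}
    (hf : ∀ i ∈ t, L1Rate μ s (f i)) : L1Rate μ s fun n ω => ∑ i ∈ t, f i n ω := by
  classical
  induction t using Finset.induction_on with
  | empty => exact ⟨0, le_rfl, fun n _ => by simp⟩
  | insert a t ha ih =>
    simp only [Finset.sum_insert ha]
    exact (hf a (Finset.mem_insert_self _ _)).add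
      (ih fun i hi => hf i (Finset.mem_insert_of_mem hi))

lemma L1Rate.of_abs_le {f g : ℕ → Ω → ℝ} (hg : L1Rate μ s g)
    (hf : ∀ n, AEStronglyMeasurable (f n) μ) (hfg : ∀ n ω, 1 ≤ n → |f n ω| ≤ g n ω) :
    L1Rate μ s f := by
  obtain ⟨C, hC, h⟩ := hg
  refine ⟨C, hC, fun n hn => ?_⟩
  have hi : Integrable (f n) μ := (h n hn).1.mono' (hf n) (Eventually.of_forall fun ω => hfg n ω hn)
  refine ⟨hi, (integral_mono hi.abs (h n hn).1.abs fun ω => ?_).trans (h n hn).2⟩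
  exact (hfg n ω hn).trans (le_abs_self _)

/-- The rate is inherited by averages. -/
lemma L1Rate.average (hs0 : 0 ≤ s) (hs1 : s < 1) {u : ℕ → Ω → ℝ} {C : ℝ} (hC : 0 ≤ C)
    (hu : ∀ k, Integrable (u k) μ) (hu' : ∀ k : ℕ, ∫ ω, |u k ω| ∂μ ≤ C * ((k : ℝ) + 1) ^ (-s)) :
    L1Rate μ s fun n ω => 1 / (n : ℝ) * ∑ k ∈ Finset.range n, u k ω := by
  have hs : 0 < 1 - s := by linarith
  refine ⟨C / (1 - s), by positivity, fun n hn => ?_⟩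
  have hn0 : (0 : ℝ) < n := by exact_mod_cast hn
  refine ⟨(integrable_finsetSum _ fun k _ => hu k).const_mul _, ?_⟩
  calc ∫ ω, |1 / (n : ℝ) * ∑ k ∈ Finset.range n, u k ω| ∂μ
      ≤ ∫ ω, 1 / (n : ℝ) * ∑ k ∈ Finset.range n, |u k ω| ∂μ := by
        refine integral_mono ((integrable_finsetSum _ fun k _ => hu k).const_mul _).abs
          ((integrable_finsetSum _ fun k _ => (hu k).abs).const_mul _) fun ω => ?_
        simp only [abs_mul, abs_of_pos (one_div_pos.2 hn0)]
        exact mul_le_mul_of_nonneg_left (Finset.abs_sum_le_sum_abs _ _) (one_div_pos.2 hn0).le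
    _ = 1 / (n : ℝ) * ∑ k ∈ Finset.range n, ∫ ω, |u k ω| ∂μ := by
        rw [integral_const_mul, integral_finsetSum _ fun k _ => (hu k).abs]
    _ ≤ 1 / (n : ℝ) * (C * ((n : ℝ) ^ (1 - s) / (1 - s))) := by
        refine mul_le_mul_of_nonneg_left ?_ (one_div_pos.2 hn0).le
        refine (Finset.sum_le_sum fun k _ => hu' k).trans ?_
        rw [← Finset.mul_sum]
        exact mul_le_mul_of_nonneg_left (sum_rpow_neg_le hs0 hs1 n) hC
    _ = _ := by
        rw [sub_eq_add_neg, Real.rpow_add hn0, Real.rpow_one]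
        field_simp

/-- Nonnegativity of the variance of `|W|`. -/
lemma integral_abs_le_sqrt [IsProbabilityMeasure μ] {W : Ω → ℝ} (hW : MemLp W 2 μ) {c : ℝ}
    (h : ∫ ω, W ω ^ 2 ∂μ ≤ c) : ∫ ω, |W ω| ∂μ ≤ √c := by
  have h1 := variance_nonneg |W| μ
  rw [variance_eq_sub hW.abs] at h1
  have h2 : ∫ ω, (|W| ^ 2) ω ∂μ = ∫ ω, W ω ^ 2 ∂μ := by simp
  have h3 : ∫ ω, |W| ω ∂μ = ∫ ω, |W ω| ∂μ := rfl
  rw [h2, h3] at h1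
  exact Real.le_sqrt_of_sq_le (by linarith)

variable {S : Type*} [MeasurableSpace S] {P : Measure S} {Z : ℕ → Ω → S}

/-- The mean of `n` independent square-integrable variables converges at the rate `n^{-1/2}`. -/
lemma L1Rate.empirical_mean [IsProbabilityMeasure μ] (hZ : ∀ n, Measurable (Z n))
    (hind : iIndepFun Z μ) (hlaw : ∀ n, μ.map (Z n) = P) {X : S → ℝ} (hXm : Measurable X)
    (hX : MemLp X 2 P) (hs : s ≤ 1 / 2) :
    L1Rate μ s fun n ω => 1 / (n : ℝ) * ∑ k ∈ Finset.range n, X (Z k ω) - ∫ z, X z ∂P := by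
  have hmem : ∀ k, MemLp (fun ω => X (Z k ω)) 2 μ := fun k =>
    (memLp_map_measure_iff (hlaw k ▸ hX.1) (hZ k).aemeasurable).1 (hlaw k ▸ hX)
  have hint : ∀ k, ∫ ω, X (Z k ω) ∂μ = ∫ z, X z ∂P := fun k => by
    rw [← hlaw k, integral_map (hZ k).aemeasurable hXm.aestronglyMeasurable]
  set v : ℝ := Var[fun ω => X (Z 0 ω); μ] with hv
  have hvar : ∀ k, Var[fun ω => X (Z k ω); μ] = v := fun k => by
    have e : ∀ k, Var[fun ω => X (Z k ω); μ] = Var[X; P] := fun k => by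
      have hk : AEMeasurable (fun ω => X (Z k ω)) μ := (hXm.comp (hZ k)).aemeasurable
      rw [variance_eq_integral hk, variance_eq_integral hXm.aemeasurable, hint k, ← hlaw k,
        integral_map (hZ k).aemeasurable ((hXm.sub_const _).pow_const 2).aestronglyMeasurable]
    rw [hv, e, e]
  have hv0 : 0 ≤ v := variance_nonneg _ _
  refine ⟨√v, Real.sqrt_nonneg _, fun n hn => ?_⟩
  have hn0 : (0 : ℝ) < n := by exact_mod_cast hn
  have hn1 : (1 : ℝ) ≤ n := by exact_mod_cast hn
  set W : Ω → ℝ := fun ω => 1 / (n : ℝ) * ∑ k ∈ Finset.range n, X (Z k ω) with hW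
  have hWm : MemLp W 2 μ := (memLp_finsetSum _ fun k _ => hmem k).const_mul _
  have hWint : ∫ ω, W ω ∂μ = ∫ z, X z ∂P := by
    simp only [hW]
    rw [integral_const_mul, integral_finsetSum _ fun k _ => (hmem k).integrable one_le_two]
    simp only [hint, Finset.sum_const, Finset.card_range, nsmul_eq_mul]
    field_simp
  have hWvar : Var[W; μ] = v / n := by
    have h1 := IndepFun.variance_sum (μ := μ) (s := Finset.range n)
      (X := fun k ω => X (Z k ω)) (fun k _ => hmem k)
      (fun i _ j _ hij => (hind.indepFun hij).comp hXm hXm)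
    have e : W = fun ω => 1 / (n : ℝ) * (∑ k ∈ Finset.range n, fun ω => X (Z k ω)) ω := by
      funext ω
      simp [hW]
    rw [e, variance_const_mul, h1]
    simp only [hvar, Finset.sum_const, Finset.card_range, nsmul_eq_mul]
    field_simp
  have hdiff : MemLp (fun ω => W ω - ∫ z, X z ∂P) 2 μ := hWm.sub (memLp_const _)
  refine ⟨hdiff.integrable one_le_two, (integral_abs_le_sqrt hdiff (c := v / n) ?_).trans ?_⟩
  · rw [← hWvar, variance_eq_integral hWm.1.aemeasurable, hWint]
  · rw [Real.sqrt_div hv0, div_eq_mul_inv, Real.sqrt_eq_rpow n, ← Real.rpow_neg hn0.le]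
    -- Since `s ≤ 1/2` and `1 ≤ n`, the rate `n^{-1/2}` may be weakened to `n^{-s}`.
    exact mul_le_mul_of_nonneg_left
      (Real.rpow_le_rpow_of_exponent_le hn1 (by linarith)) (Real.sqrt_nonneg _)

end Rates

/-! ### Moments of the iterates and of the gradient at the minimizer. -/

section Iterates

variable {p : ℕ} {S : Type*} [MeasurableSpace S] {P : Measure S} [IsProbabilityMeasure P]
  {Ω : Type*} [MeasurableSpace Ω] {μ : Measure Ω} [IsProbabilityMeasure μ] {Z : ℕ → Ω → S}
  {ℓ : S → Vec p → ℝ} {θs θ₀ : Vec p} {γ₁ γ : ℝ} {β : S → ℝ} {M : ℝ}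

/-- First and second moments of the error of the iterates. -/
lemma exists_moments_proxRM_le (h : RegularSample P ℓ θs β M) (hγ₁ : 0 < γ₁)
    (hZ : ∀ n, Measurable (Z n)) (hind : iIndepFun Z μ) (hlaw : ∀ n, μ.map (Z n) = P)
    {a : ℝ} (ha0 : 0 < a) (ha : ∀ θ, a / 2 * ‖θ - θs‖ ^ 2 ≤ risk P ℓ θ - risk P ℓ θs)
    (hγ : (γ = 1 ∧ 2 ≤ a * γ₁) ∨ (1 / 2 < γ ∧ γ < 1)) :
    ∃ K : ℝ, 0 < K ∧ ∀ n : ℕ,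
      MemLp (fun ω => ‖proxRM ℓ γ₁ γ θ₀ (fun k => Z k ω) n - θs‖) 2 μ ∧
      ∫ ω, ‖proxRM ℓ γ₁ γ θ₀ (fun k => Z k ω) n - θs‖ ^ 2 ∂μ ≤ K * ((n : ℝ) + 1) ^ (-γ) ∧
      ∫ ω, ‖proxRM ℓ γ₁ γ θ₀ (fun k => Z k ω) n - θs‖ ∂μ ≤ √K * ((n : ℝ) + 1) ^ (-(γ / 2)) := by
  obtain ⟨K, hK, hle⟩ := exists_lintegral_proxRM_le (θ₀ := θ₀) h hγ₁ hZ hind hlaw ha0 ha hγ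
  refine ⟨K, hK, fun n => ?_⟩
  have hm := ((measurable_proxRM (θ₀ := θ₀) (γ := γ) h hγ₁ hZ n).sub_const θs).norm
  have hi : Integrable (fun ω => ‖proxRM ℓ γ₁ γ θ₀ (fun k => Z k ω) n - θs‖ ^ 2) μ := by
    refine ⟨(hm.pow_const 2).aestronglyMeasurable, ?_⟩
    rw [hasFiniteIntegral_iff_ofReal (Eventually.of_forall fun ω => sq_nonneg _)]
    exact (hle n).trans_lt ENNReal.ofReal_lt_top
  have hmem : MemLp (fun ω => ‖proxRM ℓ γ₁ γ θ₀ (fun k => Z k ω) n - θs‖) 2 μ :=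
    (memLp_two_iff_integrable_sq hm.aestronglyMeasurable).2 hi
  have hx : (0 : ℝ) < (n : ℝ) + 1 := by positivity
  have h2 : ∫ ω, ‖proxRM ℓ γ₁ γ θ₀ (fun k => Z k ω) n - θs‖ ^ 2 ∂μ ≤ K * ((n : ℝ) + 1) ^ (-γ) := by
    rw [← ENNReal.ofReal_le_ofReal_iff (mul_nonneg hK.le (Real.rpow_nonneg hx.le _)),
      ofReal_integral_eq_lintegral_ofReal hi (Eventually.of_forall fun ω => sq_nonneg _)]
    exact hle n
  refine ⟨hmem, h2, ?_⟩
  have h3 := integral_abs_le_sqrt hmem h2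
  simp only [abs_norm] at h3
  rw [Real.sqrt_mul hK.le, Real.sqrt_eq_rpow (((n : ℝ) + 1) ^ (-γ)), ← Real.rpow_mul hx.le] at h3
  have e : -γ * (1 / 2) = -(γ / 2) := by ring
  rwa [e] at h3

/-- Near the minimizer there are points at which the stochastic error has a bounded
fourth moment. -/
lemma exists_fourth_moment_near (h : RegularSample P ℓ θs β M) (hγ₁ : 0 < γ₁)
    (hZ : ∀ n, Measurable (Z n)) (hind : iIndepFun Z μ) (hlaw : ∀ n, μ.map (Z n) = P)
    {K : ℝ} (hγ : 0 < γ)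
    (hK : ∀ n : ℕ, MemLp (fun ω => ‖proxRM ℓ γ₁ γ θ₀ (fun k => Z k ω) n - θs‖) 2 μ ∧
      ∫ ω, ‖proxRM ℓ γ₁ γ θ₀ (fun k => Z k ω) n - θs‖ ^ 2 ∂μ ≤ K * ((n : ℝ) + 1) ^ (-γ))
    {s₃ s₄ : ℝ} (hfourth : FourthMoment μ P ℓ γ₁ γ θ₀ θs Z s₃ s₄) {r : ℝ} (hr0 : 0 < r)
    (hr1 : r ≤ 1) :
    ∃ θ, ‖θ - θs‖ ≤ r ∧ ∫⁻ z, ENNReal.ofReal (‖gradient (risk P ℓ) θ - gradient (ℓ z) θ‖ ^ 4) ∂P ≤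
      ENNReal.ofReal (|s₃| + |s₄| + 1) := by
  by_contra! hcon
  have hlim : Tendsto (fun n : ℕ => K * ((n : ℝ) + 1) ^ (-γ)) atTop (𝓝 0) := by
    have := (tendsto_rpow_neg_atTop hγ).comp
      (tendsto_atTop_add_const_right atTop (1 : ℝ) (tendsto_natCast_atTop_atTop (R := ℝ)))
    simpa [Function.comp_def] using this.const_mul K
  -- Choose `n` with mean square error below `r²`: then the iterate lies in the ball with positive
  -- probability.
  obtain ⟨n, hn⟩ := (hlim.eventually_lt_const (pow_pos hr0 2)).exists
  set W : Ω → Vec p := fun ω => proxRM ℓ γ₁ γ θ₀ (fun k => Z k ω) n with hW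
  have hWp : Measurable[pastSigma Z n] W := measurable_proxRM_pastSigma h hγ₁ n
  have hWm : Measurable W := hWp.mono (pastSigma_le hZ n) le_rfl
  set D : Set (Vec p) := {θ | ‖θ - θs‖ ≤ r} with hD
  have hDm : MeasurableSet D :=
    measurableSet_le ((measurable_id.sub_const θs).norm) measurable_const
  set A : Set Ω := W ⁻¹' D with hA
  have hAp : MeasurableSet[pastSigma Z n] A := hWp hDm
  have hAm : MeasurableSet A := hWm hDm
  have hApos : μ A ≠ 0 := by
    intro h0
    have hae : ∀ᵐ ω ∂μ, r ^ 2 ≤ ‖W ω - θs‖ ^ 2 := by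
      have : ∀ᵐ ω ∂μ, ω ∉ A := measure_eq_zero_iff_ae_notMem.1 h0
      filter_upwards [this] with ω hω
      exact pow_le_pow_left₀ hr0.le (not_le.1 hω).le 2
    have := integral_mono_ae (integrable_const (r ^ 2)) (hK n).1.integrable_sq hae
    simp only [integral_const, probReal_univ, one_smul] at this
    linarith [(hK n).2]
  set c : ℝ := |s₃| + |s₄| with hc
  have hc0 : 0 ≤ c := by positivity
  have hgr : Measurable fun θ => gradient (risk P ℓ) θ :=
    (InnerProductSpace.toDual ℝ (Vec p)).symm.continuous.measurable.comp (measurable_fderiv ℝ _)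
  set f : S × Vec p → ENNReal := fun zx =>
    D.indicator (fun θ => ENNReal.ofReal (‖gradient (risk P ℓ) θ - gradient (ℓ zx.1) θ‖ ^ 4)) zx.2
    with hf
  have hfm : Measurable f := by
    have h1 : Measurable fun zx : S × Vec p =>
        ENNReal.ofReal (‖gradient (risk P ℓ) zx.2 - gradient (ℓ zx.1) zx.2‖ ^ 4) :=
      (((hgr.comp measurable_snd).sub h.measurable_gradient).norm.pow_const 4).ennreal_ofReal
    exact h1.indicator (measurable_snd hDm)
  have e1 := lintegral_observation_proxRM (θ₀ := θ₀) (γ := γ) h hγ₁ hZ hind hlaw n hfm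
  -- If every point of the ball violated the bound, integrating the new observation out first would
  -- give mass at least `(c + 1) μ A` on `A`.
  have hlow : ENNReal.ofReal (c + 1) * μ A ≤
      ∫⁻ ω, ∫⁻ z, f (z, proxRM ℓ γ₁ γ θ₀ (fun k => Z k ω) n) ∂P ∂μ := by
    rw [← lintegral_indicator_const hAm]
    refine lintegral_mono fun ω => ?_
    by_cases hω : ω ∈ A
    · have hω' : W ω ∈ D := hω
      have e : ∀ z, f (z, W ω) =
          ENNReal.ofReal (‖gradient (risk P ℓ) (W ω) - gradient (ℓ z) (W ω)‖ ^ 4) :=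
        fun z => Set.indicator_of_mem hω' _
      rw [Set.indicator_of_mem hω]
      change _ ≤ ∫⁻ z, f (z, W ω) ∂P
      simp only [e]
      exact (hcon _ hω).le
    · simp [Set.indicator_of_notMem hω]
  set G : Ω → ℝ := fun ω => ‖gradError P ℓ γ₁ γ θ₀ (fun k => Z k ω) n‖ ^ 4 with hG
  -- `A` belongs to the past, so the conditional moment bound may be integrated over it; there `‖W -
  -- θs‖ ≤ r ≤ 1` and the bound is at most `c`.
  have hup : ∫⁻ ω, f (Z n ω, proxRM ℓ γ₁ γ θ₀ (fun k => Z k ω) n) ∂μ ≤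
      ENNReal.ofReal c * μ A := by
    have hGi : Integrable G μ := hfourth.integrable n
    have e2 : ∫⁻ ω, f (Z n ω, proxRM ℓ γ₁ γ θ₀ (fun k => Z k ω) n) ∂μ =
        ∫⁻ ω in A, ENNReal.ofReal (G ω) ∂μ := by
      rw [← lintegral_indicator hAm]
      rfl
    rw [e2, ← ofReal_integral_eq_lintegral_ofReal hGi.integrableOn
      (Eventually.of_forall fun ω => by positivity),
      ← setIntegral_condExp (pastSigma_le hZ n) hGi hAp]
    have h3 : ∫ ω in A, (μ[G | pastSigma Z n]) ω ∂μ ≤ ∫ ω in A, c ∂μ := by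
      refine setIntegral_mono_on_ae integrable_condExp.integrableOn
        (integrable_const _).integrableOn hAm ?_
      filter_upwards [hfourth.bound n] with ω hω hωA
      refine hω.trans ?_
      have h4 : ‖W ω - θs‖ ^ 4 ≤ 1 := pow_le_one₀ (norm_nonneg _) (le_trans hωA hr1)
      have h5 : s₄ * ‖W ω - θs‖ ^ 4 ≤ |s₄| * 1 :=
        mul_le_mul (le_abs_self _) h4 (by positivity) (abs_nonneg _)
      have h6 := le_abs_self s₃
      simp only [hc]
      linarith
    rw [setIntegral_const, smul_eq_mul] at h3
    refine (ENNReal.ofReal_le_ofReal h3).trans ?_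
    rw [mul_comm, ENNReal.ofReal_mul hc0, Measure.real, ENNReal.ofReal_toReal (measure_ne_top μ A)]
  have hfin := (e1 ▸ hlow).trans hup
  have hlt : ENNReal.ofReal c * μ A < ENNReal.ofReal (c + 1) * μ A :=
    ENNReal.mul_lt_mul_left hApos (measure_ne_top μ A)
      ((ENNReal.ofReal_lt_ofReal_iff (by linarith)).2 (by linarith))
  exact absurd hfin (not_le.2 hlt)

omit [IsProbabilityMeasure P] in
/-- The sample gradient at the minimizer has a fourth moment. -/
lemma lintegral_gradient_pow_four_lt_top (h : RegularSample P ℓ θs β M) {C : ENNReal}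
    (hC : C ≠ ⊤)
    (hnear : ∀ r : ℝ, 0 < r → r ≤ 1 → ∃ θ, ‖θ - θs‖ ≤ r ∧
      ∫⁻ z, ENNReal.ofReal (‖gradient (risk P ℓ) θ - gradient (ℓ z) θ‖ ^ 4) ∂P ≤ C) :
    ∫⁻ z, ENNReal.ofReal (‖gradient (ℓ z) θs‖ ^ 4) ∂P < ⊤ := by
  have hr : ∀ n : ℕ, (0 : ℝ) < 1 / ((n : ℝ) + 1) := fun n => by positivity
  have hr1 : ∀ n : ℕ, 1 / ((n : ℝ) + 1) ≤ 1 := fun n => by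
    rw [div_le_one (by positivity)]; linarith [n.cast_nonneg (α := ℝ)]
  choose x hx hxC using fun n : ℕ => hnear _ (hr n) (hr1 n)
  have hxlim : Tendsto x atTop (𝓝 θs) := by
    rw [tendsto_iff_norm_sub_tendsto_zero]
    exact squeeze_zero (fun _ => norm_nonneg _) hx tendsto_one_div_add_atTop_nhds_zero_nat
  have hgrad : ∀ {f : Vec p → ℝ}, TwiceDifferentiableAt f θs →
      Tendsto (fun n => gradient f (x n)) atTop (𝓝 (gradient f θs)) := fun hf =>
    ((InnerProductSpace.toDual ℝ (Vec p)).symm.continuous.tendsto _).comp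
      (hf.2.continuousAt.tendsto.comp hxlim)
  have hpt : ∀ z, Tendsto (fun n =>
      ENNReal.ofReal (‖gradient (risk P ℓ) (x n) - gradient (ℓ z) (x n)‖ ^ 4)) atTop
      (𝓝 (ENNReal.ofReal (‖gradient (ℓ z) θs‖ ^ 4))) := fun z => by
    have h1 := (((hgrad h.twice_risk).sub (hgrad (h.twice z θs))).norm.pow 4)
    rw [h.gradient_risk_min, zero_sub, norm_neg] at h1
    exact (ENNReal.continuous_ofReal.tendsto _).comp h1
  -- Fatou along points tending to `θs`: the sample gradients converge there and the gradient of the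
  -- risk tends to `0`.
  have hF := lintegral_liminf_le (μ := P) (u := atTop) (f := fun (n : ℕ) z =>
      ENNReal.ofReal (‖gradient (risk P ℓ) (x n) - gradient (ℓ z) (x n)‖ ^ 4)) fun n =>
    ((measurable_const.sub (h.measurable_gradient_at (x n))).norm.pow_const 4).ennreal_ofReal
  simp only [fun z => (hpt z).liminf_eq] at hF
  refine (hF.trans ?_).trans_lt (lt_top_iff_ne_top.2 hC)
  exact liminf_le_of_frequently_le' (Frequently.of_forall hxC)

end Iterates

/-! ### Measurability and integrability of matrices through their entries -/

lemma stronglyMeasurable_mat {p : ℕ} {S : Type*} [MeasurableSpace S] {Λ : S → Mat p}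
    (h : ∀ i j, Measurable fun z => Λ z i j) : StronglyMeasurable Λ := by
  rw [funext fun z => mat_eq_sum_smul_single (Λ z)]
  exact Finset.stronglyMeasurable_fun_sum _ fun i _ => Finset.stronglyMeasurable_fun_sum _
    fun j _ => (h i j).stronglyMeasurable.smul_const _

lemma integrable_mat {p : ℕ} {S : Type*} [MeasurableSpace S] {P : Measure S} {Λ : S → Mat p}
    (h : ∀ i j, Integrable (fun z => Λ z i j) P) : Integrable Λ P := by
  rw [funext fun z => mat_eq_sum_smul_single (Λ z)]
  exact integrable_finsetSum _ fun i _ => integrable_finsetSum _ fun j _ => (h i j).smul_const _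

/-- Serves the measurability of the estimator. The matrix is symmetrized because `eigFloor` leaves
non-Hermitian matrices unchanged, so its good behaviour is confined to Hermitian ones. Continuity at
each point is the local Lipschitz estimate based there. -/
lemma continuous_covMap_eigFloor {p : ℕ} {γ₁ γ δ : ℝ} (hγ₁ : 0 < γ₁)
    (hδ : betaPlus γ / (2 * γ₁) < δ) :
    Continuous fun AJ : Mat p × Mat p =>
      covMap γ₁ γ (eigFloor δ ((1 / 2 : ℝ) • (AJ.1 + AJ.1.transpose))) AJ.2 := by
  set sym : Mat p → Mat p := fun A => (1 / 2 : ℝ) • (A + A.transpose) with hsym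
  have hherm : ∀ A, (sym A).IsHermitian := fun A => by
    ext i j
    simp [hsym, add_comm]
  have hfv : Continuous (fvec (p := p)) := LinearMap.continuous_of_finiteDimensional _
  have hsymc : Continuous sym := by
    have : Continuous fun A : Mat p => A.transpose := continuous_id.matrix_transpose
    exact (continuous_id.add this).const_smul (1 / 2 : ℝ)
  obtain ⟨C, hC0, hC⟩ := exists_norm_le_fvec p
  refine continuous_iff_continuousAt.2 fun ⟨A₀, J₀⟩ => ?_
  obtain ⟨K, hK0, hK⟩ := exists_covMap_sub_le hγ₁ hδ (eigFloor_decomp δ (hherm A₀)).1 J₀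
  rw [ContinuousAt, tendsto_iff_norm_sub_tendsto_zero]
  have hb : ∀ AJ : Mat p × Mat p,
      ‖covMap γ₁ γ (eigFloor δ (sym AJ.1)) AJ.2 - covMap γ₁ γ (eigFloor δ (sym A₀)) J₀‖ ≤
        C * (K * (‖fvec (sym AJ.1) - fvec (sym A₀)‖ + ‖fvec AJ.2 - fvec J₀‖)) := fun AJ => by
    refine (hC _).trans (mul_le_mul_of_nonneg_left ?_ hC0.le)
    rw [map_sub]
    refine (hK _ AJ.2 (eigFloor_decomp δ (hherm AJ.1)).1).trans ?_
    exact mul_le_mul_of_nonneg_left (add_le_add_left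
      (norm_fvec_eigFloor_sub_eigFloor_le (hherm _) (hherm _)) _) hK0.le
  have hcont : Continuous fun AJ : Mat p × Mat p =>
      C * (K * (‖fvec (sym AJ.1) - fvec (sym A₀)‖ + ‖fvec AJ.2 - fvec J₀‖)) := by
    have h1 : Continuous fun AJ : Mat p × Mat p => fvec (sym AJ.1) :=
      hfv.comp (hsymc.comp continuous_fst)
    have h2 : Continuous fun AJ : Mat p × Mat p => fvec AJ.2 := hfv.comp continuous_snd
    fun_prop
  have hlim := hcont.tendsto (A₀, J₀)
  simp only [sub_self, norm_zero, add_zero, mul_zero] at hlim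
  exact squeeze_zero (fun _ => norm_nonneg _) hb hlim

/-! ### Rates of the empirical matrices -/

section Estimators

variable {p : ℕ} {S : Type*} [MeasurableSpace S] {P : Measure S} [IsProbabilityMeasure P]
  {Ω : Type*} [MeasurableSpace Ω] {μ : Measure Ω} [IsProbabilityMeasure μ] {Z : ℕ → Ω → S}
  {ℓ : S → Vec p → ℝ} {θs θ₀ : Vec p} {γ₁ γ : ℝ} {β : S → ℝ} {M : ℝ}

omit [IsProbabilityMeasure P] in
-- The gradient moves from `θs` at rate at most `|β z|`, which bounds its derivative there. Hence
-- Hessian entries at `θs` are square integrable.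
lemma RegularSample.abs_hessian_apply_le (h : RegularSample P ℓ θs β M) (z : S) (i j : Fin p) :
    |hessian (ℓ z) θs i j| ≤ |β z| := by
  have h1 : ‖fderiv ℝ (fderiv ℝ (ℓ z)) θs‖ ≤ |β z| := by
    refine (h.twice z θs).2.hasFDerivAt.le_of_lip' (abs_nonneg _) (Eventually.of_forall fun x => ?_)
    rw [← norm_gradient_sub]
    exact (h.lipschitz z x).trans (mul_le_mul_of_nonneg_right (le_abs_self _) (norm_nonneg _))
  have h2 := (fderiv ℝ (fderiv ℝ (ℓ z)) θs).le_opNorm₂ (EuclideanSpace.single i 1)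
    (EuclideanSpace.single j 1)
  simp only [PiLp.norm_single, norm_one, mul_one] at h2
  exact h2.trans h1

omit [IsProbabilityMeasure P] [IsProbabilityMeasure μ] in
lemma integral_observation_mul_proxRM (h : RegularSample P ℓ θs β M) (hγ₁ : 0 < γ₁)
    (hZ : ∀ n, Measurable (Z n)) (hind : iIndepFun Z μ) (hlaw : ∀ n, μ.map (Z n) = P) (n : ℕ)
    {f : S → ℝ} (hf : Measurable f) (hfi : Integrable f P) {g : Vec p → ℝ} (hg : Measurable g)
    (hgi : Integrable (fun ω => g (proxRM ℓ γ₁ γ θ₀ (fun k => Z k ω) n)) μ) :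
    Integrable (fun ω => f (Z n ω) * g (proxRM ℓ γ₁ γ θ₀ (fun k => Z k ω) n)) μ ∧
      ∫ ω, f (Z n ω) * g (proxRM ℓ γ₁ γ θ₀ (fun k => Z k ω) n) ∂μ =
        (∫ z, f z ∂P) * ∫ ω, g (proxRM ℓ γ₁ γ θ₀ (fun k => Z k ω) n) ∂μ := by
  have hi := (indepFun_proxRM (θ₀ := θ₀) (γ := γ) h hγ₁ hZ hind n).comp hf hg
  have hfi' : Integrable (f ∘ Z n) μ :=
    (integrable_map_measure (hlaw n ▸ hfi.1) (hZ n).aemeasurable).1 (hlaw n ▸ hfi)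
  refine ⟨hi.integrable_mul hfi' hgi, ?_⟩
  have h1 := hi.integral_fun_mul_eq_mul_integral hfi'.1 hgi.1
  have h2 : ∫ ω, (f ∘ Z n) ω ∂μ = ∫ z, f z ∂P := by
    rw [← hlaw n, integral_map (hZ n).aemeasurable hf.aestronglyMeasurable]
    rfl
  rw [h2] at h1
  exact h1

omit [IsProbabilityMeasure P] [IsProbabilityMeasure μ] in
lemma measurable_hatH_apply (h : RegularSample P ℓ θs β M) (hγ₁ : 0 < γ₁)
    (hZ : ∀ n, Measurable (Z n)) (n : ℕ) (i j : Fin p) :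
    Measurable fun ω => hatH ℓ γ₁ γ θ₀ (fun k => Z k ω) n i j := by
  simp only [hatH, Matrix.smul_apply, Matrix.sum_apply, smul_eq_mul]
  refine Measurable.const_mul (Finset.measurable_fun_sum _ fun k _ => ?_) _
  exact (h.measurable_hessian_apply i j).comp ((hZ k).prodMk (measurable_proxRM h hγ₁ hZ k))

omit [IsProbabilityMeasure P] [IsProbabilityMeasure μ] in
lemma measurable_hatI_apply (h : RegularSample P ℓ θs β M) (hγ₁ : 0 < γ₁)
    (hZ : ∀ n, Measurable (Z n)) (n : ℕ) (i j : Fin p) :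
    Measurable fun ω => hatI ℓ γ₁ γ θ₀ (fun k => Z k ω) n i j := by
  simp only [hatI, Matrix.smul_apply, Matrix.sum_apply, outer, Matrix.of_apply, smul_eq_mul]
  refine Measurable.const_mul (Finset.measurable_fun_sum _ fun k _ => ?_) _
  have hg : Measurable fun ω => gradient (ℓ (Z k ω)) (proxRM ℓ γ₁ γ θ₀ (fun k => Z k ω) k) :=
    h.measurable_gradient.comp ((hZ k).prodMk (measurable_proxRM h hγ₁ hZ k))
  exact ((EuclideanSpace.proj i).continuous.measurable.comp hg).mul
    ((EuclideanSpace.proj j).continuous.measurable.comp hg)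

omit [MeasurableSpace Ω] [IsProbabilityMeasure P] [IsProbabilityMeasure μ] in
lemma hatH_isHermitian (h : RegularSample P ℓ θs β M) (z : ℕ → S) (n : ℕ) :
    (hatH ℓ γ₁ γ θ₀ z n).IsHermitian := by
  ext i j
  simp only [hatH, Matrix.conjTranspose_apply, Matrix.smul_apply, Matrix.sum_apply, star_trivial]
  congr 1
  refine Finset.sum_congr rfl fun k _ => ?_
  simpa using congrFun (congrFun (h.twice (z k) (proxRM ℓ γ₁ γ θ₀ z k)).hessian_isHermitian i) j

/-- Moving each sample Hessian to `θs` costs a multiple of `‖θ_k - θs‖`, with mean `O(k^{-γ/2})`.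
What remains is an i.i.d. mean of square-integrable variables centred at the Hessian of the risk. -/
lemma hatH_rate (h : RegularSample P ℓ θs β M) (hγ₁ : 0 < γ₁)
    (hZ : ∀ n, Measurable (Z n)) (hind : iIndepFun Z μ) (hlaw : ∀ n, μ.map (Z n) = P)
    {a : ℝ} (ha0 : 0 < a) (ha : ∀ θ, a / 2 * ‖θ - θs‖ ^ 2 ≤ risk P ℓ θ - risk P ℓ θs)
    (hγ : (γ = 1 ∧ 2 ≤ a * γ₁) ∨ (1 / 2 < γ ∧ γ < 1)) (i j : Fin p) :
    L1Rate μ (γ / 2) fun n ω =>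
      hatH ℓ γ₁ γ θ₀ (fun k => Z k ω) n i j - hessian (risk P ℓ) θs i j := by
  have hγ0 : 0 < γ := by rcases hγ with h | h <;> linarith [h.1]
  have hγ1 : γ ≤ 1 := by rcases hγ with h | h <;> [exact h.1.le; exact h.2.le]
  obtain ⟨K, hK0, hK⟩ := exists_moments_proxRM_le (θ₀ := θ₀) h hγ₁ hZ hind hlaw ha0 ha hγ
  have havg : L1Rate μ (γ / 2) fun n ω => 1 / (n : ℝ) * ∑ k ∈ Finset.range n,
      ‖proxRM ℓ γ₁ γ θ₀ (fun k => Z k ω) k - θs‖ :=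
    L1Rate.average (by linarith) (by linarith) (Real.sqrt_nonneg K)
      (fun k => (hK k).1.integrable one_le_two) fun k => by simpa using (hK k).2.2
  have hXm : Measurable fun z => hessian (ℓ z) θs i j :=
    (h.measurable_hessian_apply i j).comp (measurable_id.prodMk measurable_const)
  have hX : MemLp (fun z => hessian (ℓ z) θs i j) 2 P :=
    h.memLp_beta.mono hXm.aestronglyMeasurable (Eventually.of_forall fun z =>
      h.abs_hessian_apply_le z i j)
  have hemp := L1Rate.empirical_mean (s := γ / 2) hZ hind hlaw hXm hX (by linarith)
  set E := LinearMap.toContinuousLinearMap (Matrix.entryLinearMap ℝ ℝ i j) with hE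
  refine ((havg.const_mul (‖E‖ * |M|)).add hemp.abs).of_abs_le
    (fun n => ((measurable_hatH_apply h hγ₁ hZ n i j).sub_const _).aestronglyMeasurable)
    fun n ω hn => ?_
  have hn0 : (0 : ℝ) < n := by exact_mod_cast hn
  have hent : ∀ k, |hessian (ℓ (Z k ω)) (proxRM ℓ γ₁ γ θ₀ (fun k => Z k ω) k) i j -
      hessian (ℓ (Z k ω)) θs i j| ≤
        ‖E‖ * |M| * ‖proxRM ℓ γ₁ γ θ₀ (fun k => Z k ω) k - θs‖ := fun k => by
    refine (E.le_opNorm (hessian (ℓ (Z k ω)) (proxRM ℓ γ₁ γ θ₀ (fun k => Z k ω) k) -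
      hessian (ℓ (Z k ω)) θs)).trans ?_
    rw [mul_assoc]
    refine mul_le_mul_of_nonneg_left ((h.hessian_lipschitz _ _).trans ?_) (norm_nonneg _)
    exact mul_le_mul_of_nonneg_right (le_abs_self _) (norm_nonneg _)
  rw [h.hessian_risk_apply]
  have hsplit : hatH ℓ γ₁ γ θ₀ (fun k => Z k ω) n i j - ∫ z, hessian (ℓ z) θs i j ∂P =
      1 / (n : ℝ) * ∑ k ∈ Finset.range n,
        (hessian (ℓ (Z k ω)) (proxRM ℓ γ₁ γ θ₀ (fun k => Z k ω) k) i j -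
          hessian (ℓ (Z k ω)) θs i j) +
      (1 / (n : ℝ) * ∑ k ∈ Finset.range n, hessian (ℓ (Z k ω)) θs i j -
        ∫ z, hessian (ℓ z) θs i j ∂P) := by
    simp only [hatH, Matrix.smul_apply, Matrix.sum_apply, smul_eq_mul, Finset.sum_sub_distrib]
    ring
  rw [hsplit]
  refine (abs_add_le _ _).trans (add_le_add_left ?_ _)
  rw [abs_mul, abs_of_pos (one_div_pos.2 hn0), mul_left_comm]
  refine mul_le_mul_of_nonneg_left ?_ (one_div_pos.2 hn0).le
  rw [Finset.mul_sum]
  exact (Finset.abs_sum_le_sum_abs _ _).trans (Finset.sum_le_sum fun k _ => hent k)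

/-- The same splitting as for the Hessians. The increment now carries random factors depending on
the current observation; these are independent of the iterate, so expectations factor. -/
lemma hatI_rate (h : RegularSample P ℓ θs β M) (hγ₁ : 0 < γ₁)
    (hZ : ∀ n, Measurable (Z n)) (hind : iIndepFun Z μ) (hlaw : ∀ n, μ.map (Z n) = P)
    {a : ℝ} (ha0 : 0 < a) (ha : ∀ θ, a / 2 * ‖θ - θs‖ ^ 2 ≤ risk P ℓ θ - risk P ℓ θs)
    (hγ : (γ = 1 ∧ 2 ≤ a * γ₁) ∨ (1 / 2 < γ ∧ γ < 1))
    {s₃ s₄ : ℝ} (hfourth : FourthMoment μ P ℓ γ₁ γ θ₀ θs Z s₃ s₄) (i j : Fin p) :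
    L1Rate μ (γ / 2) fun n ω => hatI ℓ γ₁ γ θ₀ (fun k => Z k ω) n i j - infoMat P ℓ θs i j := by
  have hγ0 : 0 < γ := by rcases hγ with h | h <;> linarith [h.1]
  have hγ1 : γ ≤ 1 := by rcases hγ with h | h <;> [exact h.1.le; exact h.2.le]
  obtain ⟨K, hK0, hK⟩ := exists_moments_proxRM_le (θ₀ := θ₀) h hγ₁ hZ hind hlaw ha0 ha hγ
  -- Square integrability of the outer products, needed for the `n^{-1/2}` rate of their mean.
  have h4 : Integrable (fun z => ‖gradient (ℓ z) θs‖ ^ 4) P := by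
    refine ⟨((h.measurable_gradient_at θs).norm.pow_const 4).aestronglyMeasurable, ?_⟩
    rw [hasFiniteIntegral_iff_ofReal (Eventually.of_forall fun z => by positivity)]
    exact lintegral_gradient_pow_four_lt_top h ENNReal.ofReal_ne_top fun r hr0 hr1 =>
      exists_fourth_moment_near h hγ₁ hZ hind hlaw hγ0
        (fun n => ⟨(hK n).1, (hK n).2.1⟩) hfourth hr0 hr1
  have hcoord : ∀ (v : Vec p) (i : Fin p), |v i| ≤ ‖v‖ := fun v i => PiLp.norm_apply_le v i
  have hXm : ∀ i j, Measurable fun z => outer (gradient (ℓ z) θs) i j := fun i j =>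
    ((EuclideanSpace.proj i).continuous.measurable.comp (h.measurable_gradient_at θs)).mul
      ((EuclideanSpace.proj j).continuous.measurable.comp (h.measurable_gradient_at θs))
  have hX : ∀ i j, MemLp (fun z => outer (gradient (ℓ z) θs) i j) 2 P := fun i j => by
    rw [memLp_two_iff_integrable_sq (hXm i j).aestronglyMeasurable]
    refine h4.mono' ((hXm i j).pow_const 2).aestronglyMeasurable (Eventually.of_forall fun z => ?_)
    rw [Real.norm_eq_abs, abs_pow]
    simp only [outer, Matrix.of_apply, abs_mul]
    calc (|gradient (ℓ z) θs i| * |gradient (ℓ z) θs j|) ^ 2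
        ≤ (‖gradient (ℓ z) θs‖ * ‖gradient (ℓ z) θs‖) ^ 2 := by
          have := hcoord (gradient (ℓ z) θs)
          gcongr <;> exact this _
      _ = _ := by ring
  have hinfo : infoMat P ℓ θs i j = ∫ z, outer (gradient (ℓ z) θs) i j ∂P :=
    integral_mat_apply (integrable_mat fun i j => (hX i j).integrable one_le_two) i j
  have hemp := L1Rate.empirical_mean (s := γ / 2) hZ hind hlaw (hXm i j) (hX i j) (by linarith)
  set e : ℕ → Ω → ℝ := fun k ω => ‖proxRM ℓ γ₁ γ θ₀ (fun k => Z k ω) k - θs‖ with he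
  -- From `v vᵀ - w wᵀ = (v - w) vᵀ + w (v - w)ᵀ` with `‖v - w‖ ≤ β e` and `‖v‖ ≤ ‖w‖ + β e`.
  set u : ℕ → Ω → ℝ := fun k ω => 2 * ((β (Z k ω) * ‖gradient (ℓ (Z k ω)) θs‖) * e k ω) +
    β (Z k ω) ^ 2 * e k ω ^ 2 with hu
  have hβe : ∀ k ω, 0 ≤ β (Z k ω) * e k ω := fun k ω =>
    (norm_nonneg _).trans (h.lipschitz (Z k ω) _)
  have hu0 : ∀ k ω, 0 ≤ u k ω := fun k ω => by
    have := mul_nonneg (hβe k ω) (norm_nonneg (gradient (ℓ (Z k ω)) θs))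
    simp only [hu]
    nlinarith [sq_nonneg (β (Z k ω) * e k ω)]
  set c₁ := ∫ z, β z * ‖gradient (ℓ z) θs‖ ∂P with hc₁
  set c₂ := ∫ z, β z ^ 2 ∂P with hc₂
  have hc₂0 : 0 ≤ c₂ := integral_nonneg fun z => sq_nonneg _
  have hprod : ∀ k, (Integrable (fun ω => (β (Z k ω) * ‖gradient (ℓ (Z k ω)) θs‖) * e k ω) μ ∧
      ∫ ω, (β (Z k ω) * ‖gradient (ℓ (Z k ω)) θs‖) * e k ω ∂μ = c₁ * ∫ ω, e k ω ∂μ) := fun k =>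
    integral_observation_mul_proxRM h hγ₁ hZ hind hlaw k
      (f := fun z => β z * ‖gradient (ℓ z) θs‖) (g := fun θ => ‖θ - θs‖)
      (h.measurable_beta.mul (h.measurable_gradient_at θs).norm)
      (h.memLp_beta.integrable_mul h.memLp_gradient.norm)
      (measurable_id.sub_const θs).norm ((hK k).1.integrable one_le_two)
  have hprod2 : ∀ k, (Integrable (fun ω => β (Z k ω) ^ 2 * e k ω ^ 2) μ ∧
      ∫ ω, β (Z k ω) ^ 2 * e k ω ^ 2 ∂μ = c₂ * ∫ ω, e k ω ^ 2 ∂μ) := fun k =>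
    integral_observation_mul_proxRM h hγ₁ hZ hind hlaw k
      (f := fun z => β z ^ 2) (g := fun θ => ‖θ - θs‖ ^ 2)
      (h.measurable_beta.pow_const 2) h.integrable_beta_sq
      ((measurable_id.sub_const θs).norm.pow_const 2) (hK k).1.integrable_sq
  have hui : ∀ k, Integrable (u k) μ := fun k => ((hprod k).1.const_mul 2).add (hprod2 k).1
  have havg : L1Rate μ (γ / 2) fun n ω => 1 / (n : ℝ) * ∑ k ∈ Finset.range n, u k ω := by
    refine L1Rate.average (C := 2 * (|c₁| * √K) + c₂ * K) (by linarith) (by linarith)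
      (by positivity) hui fun k => ?_
    simp only [abs_of_nonneg (hu0 _ _)]
    simp only [hu]
    rw [integral_add ((hprod k).1.const_mul 2) (hprod2 k).1, integral_const_mul, (hprod k).2,
      (hprod2 k).2]
    have hx1 : (1 : ℝ) ≤ (k : ℝ) + 1 := by linarith [k.cast_nonneg (α := ℝ)]
    -- The quadratic term decays at the full rate `γ`, better than required.
    have hr : ((k : ℝ) + 1) ^ (-γ) ≤ ((k : ℝ) + 1) ^ (-(γ / 2)) :=
      Real.rpow_le_rpow_of_exponent_le hx1 (by linarith)
    have h1 : c₁ * ∫ ω, e k ω ∂μ ≤ |c₁| * (√K * ((k : ℝ) + 1) ^ (-(γ / 2))) := by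
      refine (mul_le_mul_of_nonneg_right (le_abs_self c₁)
        (integral_nonneg fun ω => norm_nonneg _)).trans ?_
      exact mul_le_mul_of_nonneg_left (hK k).2.2 (abs_nonneg _)
    have h2 : c₂ * ∫ ω, e k ω ^ 2 ∂μ ≤ c₂ * (K * ((k : ℝ) + 1) ^ (-(γ / 2))) :=
      mul_le_mul_of_nonneg_left ((hK k).2.1.trans (mul_le_mul_of_nonneg_left hr hK0.le)) hc₂0
    linarith
  refine (havg.add hemp.abs).of_abs_le
    (fun n => ((measurable_hatI_apply h hγ₁ hZ n i j).sub_const _).aestronglyMeasurable)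
    fun n ω hn => ?_
  have hn0 : (0 : ℝ) < n := by exact_mod_cast hn
  have hent : ∀ k, |outer (gradient (ℓ (Z k ω)) (proxRM ℓ γ₁ γ θ₀ (fun k => Z k ω) k)) i j -
      outer (gradient (ℓ (Z k ω)) θs) i j| ≤ u k ω := fun k => by
    set v := gradient (ℓ (Z k ω)) (proxRM ℓ γ₁ γ θ₀ (fun k => Z k ω) k) with hv
    set w := gradient (ℓ (Z k ω)) θs with hw
    have hd : ‖v - w‖ ≤ β (Z k ω) * e k ω := h.lipschitz _ _
    have hvn : ‖v‖ ≤ ‖w‖ + β (Z k ω) * e k ω := h.norm_gradient_le _ _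
    have e1 : outer v i j - outer w i j = (v - w) i * v j + w i * (v - w) j := by
      simp only [outer, Matrix.of_apply, PiLp.sub_apply]
      ring
    rw [e1]
    refine (abs_add_le _ _).trans ?_
    rw [abs_mul, abs_mul]
    have b1 : |(v - w) i| * |v j| ≤ (β (Z k ω) * e k ω) * (‖w‖ + β (Z k ω) * e k ω) :=
      mul_le_mul ((hcoord _ _).trans hd) ((hcoord _ _).trans hvn) (abs_nonneg _) (hβe k ω)
    have b2 : |w i| * |(v - w) j| ≤ ‖w‖ * (β (Z k ω) * e k ω) :=
      mul_le_mul (hcoord _ _) ((hcoord _ _).trans hd) (abs_nonneg _) (norm_nonneg _)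
    simp only [hu]
    rw [← hw]
    linarith
  rw [hinfo]
  have hsplit : hatI ℓ γ₁ γ θ₀ (fun k => Z k ω) n i j - ∫ z, outer (gradient (ℓ z) θs) i j ∂P =
      1 / (n : ℝ) * ∑ k ∈ Finset.range n,
        (outer (gradient (ℓ (Z k ω)) (proxRM ℓ γ₁ γ θ₀ (fun k => Z k ω) k)) i j -
          outer (gradient (ℓ (Z k ω)) θs) i j) +
      (1 / (n : ℝ) * ∑ k ∈ Finset.range n, outer (gradient (ℓ (Z k ω)) θs) i j -
        ∫ z, outer (gradient (ℓ z) θs) i j ∂P) := by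
    simp only [hatI, Matrix.smul_apply, Matrix.sum_apply, smul_eq_mul, Finset.sum_sub_distrib]
    ring
  rw [hsplit]
  refine (abs_add_le _ _).trans (add_le_add_left ?_ _)
  rw [abs_mul, abs_of_pos (one_div_pos.2 hn0)]
  refine mul_le_mul_of_nonneg_left ?_ (one_div_pos.2 hn0).le
  exact (Finset.abs_sum_le_sum_abs _ _).trans (Finset.sum_le_sum fun k _ => hent k)

/-- The rate of the plug-in estimator for a regular sample function. -/
lemma plugIn_rate (h : RegularSample P ℓ θs β M) (hγ₁ : 0 < γ₁)
    (hZ : ∀ n, Measurable (Z n)) (hind : iIndepFun Z μ) (hlaw : ∀ n, μ.map (Z n) = P)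
    {a : ℝ} (ha0 : 0 < a) (ha : ∀ θ, a / 2 * ‖θ - θs‖ ^ 2 ≤ risk P ℓ θ - risk P ℓ θs)
    (hγ : (γ = 1 ∧ 2 ≤ a * γ₁) ∨ (1 / 2 < γ ∧ γ < 1))
    {s₃ s₄ : ℝ} (hfourth : FourthMoment μ P ℓ γ₁ γ θ₀ θs Z s₃ s₄) {δ : ℝ}
    (hδ : δ ∈ Set.Ioo (betaPlus γ / (2 * γ₁)) (lambdaMin (hessian (risk P ℓ) θs))) :
    ∃ C : ℝ, 0 ≤ C ∧ ∀ n : ℕ, 1 ≤ n →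
      Integrable (fun ω => plugIn ℓ γ₁ γ θ₀ δ (fun k => Z k ω) n - asymptoticCov P ℓ γ₁ γ θs) μ ∧
      ∫ ω, ‖plugIn ℓ γ₁ γ θ₀ δ (fun k => Z k ω) n - asymptoticCov P ℓ γ₁ γ θs‖ ∂μ ≤
        C * (n : ℝ) ^ (-(γ / 2)) := by
  have hH : GeScalar δ (hessian (risk P ℓ) θs) :=
    geScalar_of_le_lambdaMin h.twice_risk.hessian_isHermitian hδ.2.le
  obtain ⟨A, hA0, hA⟩ := exists_norm_le_fvec p
  obtain ⟨K, hK0, hK⟩ := exists_covMap_sub_le hγ₁ hδ.1 hH (infoMat P ℓ θs)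
  have hherm : ∀ (n : ℕ) ω, (hatH ℓ γ₁ γ θ₀ (fun k => Z k ω) n).IsHermitian := fun n ω =>
    hatH_isHermitian h _ n
  set D : ℕ → Ω → ℝ := fun n ω => A * K *
    (∑ i, ∑ j, |hatH ℓ γ₁ γ θ₀ (fun k => Z k ω) n i j - hessian (risk P ℓ) θs i j| +
      ∑ i, ∑ j, |hatI ℓ γ₁ γ θ₀ (fun k => Z k ω) n i j - infoMat P ℓ θs i j|) with hD
  have hDrate : L1Rate μ (γ / 2) D :=
    ((L1Rate.sum _ fun i _ => L1Rate.sum _ fun j _ =>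
        (hatH_rate h hγ₁ hZ hind hlaw ha0 ha hγ i j).abs).add
      (L1Rate.sum _ fun i _ => L1Rate.sum _ fun j _ =>
        (hatI_rate h hγ₁ hZ hind hlaw ha0 ha hγ hfourth i j).abs)).const_mul _
  have hbound : ∀ (n : ℕ) ω,
      ‖plugIn ℓ γ₁ γ θ₀ δ (fun k => Z k ω) n - asymptoticCov P ℓ γ₁ γ θs‖ ≤ D n ω := by
    intro n ω
    refine (hA _).trans ?_
    simp only [hD]
    rw [mul_assoc, map_sub]
    refine mul_le_mul_of_nonneg_left ((hK _ _ (eigFloor_decomp δ (hherm n ω)).1).trans ?_) hA0.le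
    refine mul_le_mul_of_nonneg_left (add_le_add ?_ ?_) hK0.le
    · refine (norm_fvec_eigFloor_sub_le (hherm n ω) hH).trans ?_
      rw [← map_sub]
      exact norm_fvec_le _
    · rw [← map_sub]
      exact norm_fvec_le _
  -- `hatH` is symmetric, so symmetrizing it changes nothing and the estimator is a continuous
  -- function of measurable matrices.
  have hmeas : ∀ n, StronglyMeasurable fun ω =>
      plugIn ℓ γ₁ γ θ₀ δ (fun k => Z k ω) n - asymptoticCov P ℓ γ₁ γ θs := by
    intro n
    have h1 := (continuous_covMap_eigFloor (p := p) hγ₁ hδ.1).comp_stronglyMeasurable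
      ((stronglyMeasurable_mat fun i j =>
          measurable_hatH_apply (θ₀ := θ₀) (γ := γ) h hγ₁ hZ n i j).prodMk
        (stronglyMeasurable_mat fun i j =>
          measurable_hatI_apply (θ₀ := θ₀) (γ := γ) h hγ₁ hZ n i j))
    have e : (fun ω => plugIn ℓ γ₁ γ θ₀ δ (fun k => Z k ω) n) = fun ω =>
        covMap γ₁ γ (eigFloor δ ((1 / 2 : ℝ) • (hatH ℓ γ₁ γ θ₀ (fun k => Z k ω) n +
          (hatH ℓ γ₁ γ θ₀ (fun k => Z k ω) n).transpose))) (hatI ℓ γ₁ γ θ₀ (fun k => Z k ω) n) := by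
      funext ω
      have ht : (hatH ℓ γ₁ γ θ₀ (fun k => Z k ω) n).transpose =
          hatH ℓ γ₁ γ θ₀ (fun k => Z k ω) n := by
        have := (hherm n ω).eq
        rwa [Matrix.conjTranspose_eq_transpose_of_trivial] at this
      rw [ht, ← two_smul ℝ, smul_smul, plugIn]
      norm_num
    refine StronglyMeasurable.sub ?_ stronglyMeasurable_const
    rw [e]
    exact h1
  obtain ⟨C, hC0, hC⟩ := hDrate
  refine ⟨C, hC0, fun n hn => ?_⟩
  have hi : Integrable (fun ω => plugIn ℓ γ₁ γ θ₀ δ (fun k => Z k ω) n -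
      asymptoticCov P ℓ γ₁ γ θs) μ :=
    (hC n hn).1.mono' (hmeas n).aestronglyMeasurable (Eventually.of_forall (hbound n))
  refine ⟨hi, (integral_mono hi.norm (hC n hn).1.abs fun ω => ?_).trans (hC n hn).2⟩
  exact (hbound n ω).trans (le_abs_self _)

end Estimators

/-! ### Reduction to regular sample functions -/

section Retraction

variable {p : ℕ} {S : Type*} [MeasurableSpace S] {P : Measure S}
  {ℓ : S → Vec p → ℝ} {θs θ₀ : Vec p} {γ₁ γ : ℝ} {β : S → ℝ} {M : ℝ}

omit [MeasurableSpace S] in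
lemma proxRM_comp (r : S → S) (z : ℕ → S) (n : ℕ) :
    proxRM (fun x => ℓ (r x)) γ₁ γ θ₀ z n = proxRM ℓ γ₁ γ θ₀ (fun k => r (z k)) n := by
  induction n with
  | zero => rfl
  | succ n ih => simp only [proxRM, ih]

omit [MeasurableSpace S] in
lemma plugIn_comp (r : S → S) (δ : ℝ) (z : ℕ → S) (n : ℕ) :
    plugIn (fun x => ℓ (r x)) γ₁ γ θ₀ δ z n = plugIn ℓ γ₁ γ θ₀ δ (fun k => r (z k)) n := by
  simp only [plugIn, hatH, hatI, proxRM_comp]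

lemma risk_comp {r : S → S} (hr : ∀ᵐ z ∂P, r z = z) : risk P (fun x => ℓ (r x)) = risk P ℓ := by
  funext θ
  refine integral_congr_ae ?_
  filter_upwards [hr] with z hz
  rw [hz]

lemma infoMat_comp {r : S → S} (hr : ∀ᵐ z ∂P, r z = z) :
    infoMat P (fun x => ℓ (r x)) θs = infoMat P ℓ θs := by
  refine integral_congr_ae ?_
  filter_upwards [hr] with z hz
  rw [hz]

/-- The assumptions on one observation hold surely, and the sample function becomes measurable,
after moving the observations in a null set to a good point. -/
lemma exists_retraction [IsProbabilityMeasure P] {σ : ℝ} (hconv : ConvexIntegrable P ℓ)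
    (hsmooth : SmoothAround P ℓ θs β) (hmin : IsMinOn (risk P ℓ) Set.univ θs)
    (hnoise : NoiseBound P ℓ θs σ) (htwice : TwiceDifferentiableAt (risk P ℓ) θs)
    (hhess : HessianLipschitz P ℓ θs M) :
    ∃ (r : S → S) (b : S → ℝ), (∀ᵐ z ∂P, r z = z) ∧
      RegularSample P (fun z => ℓ (r z)) θs b M := by
  set q := TopologicalSpace.denseSeq (Vec p) with hq
  set β' := hsmooth.memLp.1.mk β with hβ'
  have hint : ∀ m, AEStronglyMeasurable (fun z => ℓ z (q m)) P := fun m => (hconv.integrable _).1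
  -- The last clause fixes measurable versions at a dense sequence of parameters; continuity in `θ`
  -- extends measurability to all parameters.
  set Good : S → Prop := fun z => (∀ θ, TwiceDifferentiableAt (ℓ z) θ) ∧
    (∀ θ, ‖gradient (ℓ z) θ - gradient (ℓ z) θs‖ ≤ β' z * ‖θ - θs‖) ∧
    (∀ θ, ‖hessian (ℓ z) θ - hessian (ℓ z) θs‖ ≤ M * ‖θ - θs‖) ∧
    ∀ m, ℓ z (q m) = (hint m).mk _ z with hGood
  have hgood : ∀ᵐ z ∂P, Good z := by
    filter_upwards [hhess.twice, hsmooth.lipschitz, hhess.lipschitz, hsmooth.memLp.1.ae_eq_mk,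
      ae_all_iff.2 fun m => (hint m).ae_eq_mk] with z h1 h2 h3 h4 h5
    exact ⟨h1, fun θ => by rw [hβ', ← h4]; exact h2 θ, h3, h5⟩
  -- The bad set need not be measurable; its measurable hull is still null and makes `r` measurable.
  set N := toMeasurable P {z | ¬ Good z} with hN
  have hNm : MeasurableSet N := measurableSet_toMeasurable _ _
  have hN0 : P N = 0 := by rw [hN, measure_toMeasurable]; exact hgood
  have hNgood : ∀ z, z ∉ N → Good z := fun z hz => by
    by_contra hcon
    exact hz (subset_toMeasurable P _ hcon)
  have hNae : ∀ᵐ z ∂P, z ∉ N := measure_eq_zero_iff_ae_notMem.1 hN0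
  obtain ⟨z₀, hz₀⟩ := hNae.exists
  classical
  set r : S → S := fun z => if z ∈ N then z₀ else z with hr
  have hrm : Measurable r := Measurable.ite hNm measurable_const measurable_id
  have hrae : ∀ᵐ z ∂P, r z = z := by
    filter_upwards [hNae] with z hz
    simp [hr, hz]
  have hrgood : ∀ z, Good (r z) := fun z => by
    by_cases hz : z ∈ N
    · simpa [hr, hz] using hNgood z₀ hz₀
    · simpa [hr, hz] using hNgood z hz
  refine ⟨r, fun z => β' (r z), hrae, ?_⟩
  have hcont : ∀ z, Continuous (ℓ (r z)) := fun z =>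
    continuous_iff_continuousAt.2 fun θ =>
      ((hrgood z).1 θ).1.self_of_nhds.continuousAt
  have hβm : Measurable β' := hsmooth.memLp.1.stronglyMeasurable_mk.measurable
  exact
    { measurable := fun θ => by
        obtain ⟨x, hx, hxθ⟩ := mem_closure_iff_seq_limit.1
          (TopologicalSpace.denseRange_denseSeq (Vec p) θ)
        refine measurable_of_tendsto_metrizable (f := fun n z => ℓ (r z) (x n)) (fun n => ?_)
          (tendsto_pi_nhds.2 fun z => ((hcont z).tendsto θ).comp hxθ)
        obtain ⟨m, hm⟩ := hx n
        have : (fun z => ℓ (r z) (x n)) = fun z => (hint m).mk _ (r z) := by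
          funext z
          rw [← hm]
          exact (hrgood z).2.2.2 m
        rw [this]
        exact (hint m).stronglyMeasurable_mk.measurable.comp hrm
      convex := fun z => hconv.convex _
      integrable := fun θ => (hconv.integrable θ).congr (by
        filter_upwards [hrae] with z hz
        rw [hz])
      twice := fun z => (hrgood z).1
      measurable_beta := hβm.comp hrm
      memLp_beta := (memLp_congr_ae (by
        filter_upwards [hrae, hsmooth.memLp.1.ae_eq_mk] with z hz h2
        rw [hz, h2])).1 hsmooth.memLp
      lipschitz := fun z => (hrgood z).2.1
      hessian_lipschitz := fun z => (hrgood z).2.2.1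
      memLp_gradient := (memLp_congr_ae (by
        filter_upwards [hrae] with z hz
        rw [hz])).1 hnoise.memLp
      minimizer := by rw [risk_comp hrae]; exact hmin
      twice_risk := by rw [risk_comp hrae]; exact htwice }

end Retraction

end

/-! ### Consistency of the plug-in estimator. -/

theorem mainTheorem2 {p : ℕ} {S : Type*} [MeasurableSpace S] (P : Measure S)
    [IsProbabilityMeasure P] {Ω : Type*} [MeasurableSpace Ω] (μ : Measure Ω)
    [IsProbabilityMeasure μ]
    -- independent observations with law `P`
    (Z : ℕ → Ω → S) (hZ : ∀ n, Measurable (Z n)) (hind : iIndepFun Z μ)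
    (hlaw : ∀ n, μ.map (Z n) = P)
    (ℓ : S → Vec p → ℝ) (θs θ₀ : Vec p) (γ₁ γ : ℝ) (hγ₁ : 0 < γ₁)
    (β : S → ℝ) (Λ : S → Mat p) (σ s₃ s₄ M L₄ : ℝ)
    (hconv : ConvexIntegrable P ℓ)
    (hsmooth : SmoothAround P ℓ θs β)
    (hΛ : MatrixConvex P ℓ θs Λ)
    (hnoise : NoiseBound P ℓ θs σ)
    (htwice : TwiceDifferentiableAt (risk P ℓ) θs)
    (hfourth : FourthMoment μ P ℓ γ₁ γ θ₀ θs Z s₃ s₄)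
    (hhess : HessianLipschitz P ℓ θs M)
    (hmom : HessianMoment P ℓ θs L₄)
    (δ : ℝ)
    (hδ : δ ∈ Set.Ioo (betaPlus γ / (2 * γ₁)) (lambdaMin (hessian (risk P ℓ) θs)))
    (hγ : (γ = 1 ∧ (Real.exp 2 - 1) / lambdaMin (∫ z, Λ z ∂P) ≤ γ₁ ∧
          ((2 * γ₁) • hessian (risk P ℓ) θs - (1 : Mat p)).PosDef) ∨
        (1 / 2 < γ ∧ γ < 1)) :
    ∃ c : ℝ, 0 < c ∧ ∀ n : ℕ, 1 ≤ n →
      Integrable (fun ω => plugIn ℓ γ₁ γ θ₀ δ (fun k => Z k ω) n - asymptoticCov P ℓ γ₁ γ θs) μ ∧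
      ∫ ω, ‖plugIn ℓ γ₁ γ θ₀ δ (fun k => Z k ω) n - asymptoticCov P ℓ γ₁ γ θs‖ ∂μ
        ≤ c * stepSize γ₁ γ n ^ (1 / 2 : ℝ) := by

  -- For `p = 0` the spectrum is empty and `lambdaMin` takes the default value `0`, so it is no
  -- positive growth constant; but all matrices are then equal.
  rcases Nat.eq_zero_or_pos p with hp | hp
  · subst hp
    have h0 : ∀ n, (fun ω => plugIn ℓ γ₁ γ θ₀ δ (fun k => Z k ω) n -
        asymptoticCov P ℓ γ₁ γ θs) = fun _ => 0 := fun n =>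
      funext fun ω => Subsingleton.elim _ _
    have h1 : ∀ n ω, ‖plugIn ℓ γ₁ γ θ₀ δ (fun k => Z k ω) n - asymptoticCov P ℓ γ₁ γ θs‖ = 0 :=
      fun n ω => by rw [Subsingleton.elim (plugIn ℓ γ₁ γ θ₀ δ (fun k => Z k ω) n -
        asymptoticCov P ℓ γ₁ γ θs) 0, norm_zero]
    refine ⟨1, one_pos, fun n _ => ⟨by rw [h0]; exact integrable_const _, ?_⟩⟩
    simp only [h1, integral_zero, one_mul, stepSize]
    positivity
  have : Nonempty (Fin p) := ⟨⟨0, hp⟩⟩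
  obtain ⟨r, b, hr, hreg⟩ := exists_retraction hconv hsmooth hΛ.minimizer hnoise htwice hhess
  have hrisk : risk P (fun z => ℓ (r z)) = risk P ℓ := risk_comp hr
  have hZr : ∀ᵐ ω ∂μ, (fun k => r (Z k ω)) = fun k => Z k ω := by
    have h1 : ∀ᵐ ω ∂μ, ∀ k, r (Z k ω) = Z k ω := ae_all_iff.2 fun k =>
      ae_of_ae_map (hZ k).aemeasurable (by rw [hlaw k]; exact hr)
    filter_upwards [h1] with ω hω
    exact funext hω
  set a := lambdaMin (∫ z, Λ z ∂P) with ha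
  have ha0 : 0 < a := lambdaMin_pos hΛ.posDef
  have hgrow := hreg.quadratic_growth hΛ.integrable (by
    filter_upwards [hΛ.convexAt, hr] with z h1 h2
    rw [h2]
    exact h1) (geScalar_of_le_lambdaMin hΛ.posDef.1 ha.le)
  have hγ' : (γ = 1 ∧ 2 ≤ a * γ₁) ∨ (1 / 2 < γ ∧ γ < 1) := by
    rcases hγ with ⟨h1, h2, -⟩ | h1
    · refine Or.inl ⟨h1, ?_⟩
      rw [div_le_iff₀ ha0] at h2
      -- Only `e² - 1 ≥ 2` is used, the threshold of the Chung-type lemma.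
      have := Real.add_one_le_exp (2 : ℝ)
      linarith
    · exact Or.inr h1
  have hgrad : ∀ n, (fun ω => ‖gradError P (fun z => ℓ (r z)) γ₁ γ θ₀ (fun k => Z k ω) n‖ ^ 4)
      =ᵐ[μ] fun ω => ‖gradError P ℓ γ₁ γ θ₀ (fun k => Z k ω) n‖ ^ 4 := fun n => by
    filter_upwards [hZr] with ω hω
    have h2 : r (Z n ω) = Z n ω := congrFun hω n
    simp only [gradError, proxRM_comp, hrisk, hω, h2]
  have hfourth' : FourthMoment μ P (fun z => ℓ (r z)) γ₁ γ θ₀ θs Z s₃ s₄ :=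
    { integrable := fun n => (hfourth.integrable n).congr (hgrad n).symm
      bound := fun n => by
        filter_upwards [condExp_congr_ae (m := pastSigma Z n) (hgrad n), hfourth.bound n, hZr]
          with ω h1 h2 h3
        rw [h1, proxRM_comp, h3]
        exact h2 }
  obtain ⟨C, hC0, hC⟩ := plugIn_rate hreg hγ₁ hZ hind hlaw ha0 hgrow hγ' hfourth'
    (by rw [hrisk]; exact hδ)
  have hγ₁' : 0 < γ₁ ^ (1 / 2 : ℝ) := Real.rpow_pos_of_pos hγ₁ _
  -- The division converts `n^{-γ/2}` into the square root of the step size; the `1` makes the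
  -- constant positive when `C = 0`.
  refine ⟨C / γ₁ ^ (1 / 2 : ℝ) + 1, by positivity, fun n hn => ?_⟩
  have hn0 : (0 : ℝ) < n := by exact_mod_cast hn
  have hae : (fun ω => plugIn (fun z => ℓ (r z)) γ₁ γ θ₀ δ (fun k => Z k ω) n -
      asymptoticCov P (fun z => ℓ (r z)) γ₁ γ θs) =ᵐ[μ]
      fun ω => plugIn ℓ γ₁ γ θ₀ δ (fun k => Z k ω) n - asymptoticCov P ℓ γ₁ γ θs := by
    filter_upwards [hZr] with ω hω
    rw [plugIn_comp, hω, asymptoticCov, asymptoticCov, hrisk, infoMat_comp hr]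
  obtain ⟨h1, h2⟩ := hC n hn
  refine ⟨h1.congr hae, ?_⟩
  refine ((integral_congr_ae (hae.fun_comp norm)).symm.trans_le h2).trans ?_
  have hstep : stepSize γ₁ γ n ^ (1 / 2 : ℝ) = γ₁ ^ (1 / 2 : ℝ) * (n : ℝ) ^ (-(γ / 2)) := by
    rw [stepSize, Real.mul_rpow hγ₁.le (Real.rpow_nonneg hn0.le _), ← Real.rpow_mul hn0.le]
    congr 2
    ring
  have hnr : 0 ≤ (n : ℝ) ^ (-(γ / 2)) := Real.rpow_nonneg hn0.le _
  rw [hstep]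
  calc C * (n : ℝ) ^ (-(γ / 2))
      = C / γ₁ ^ (1 / 2 : ℝ) * (γ₁ ^ (1 / 2 : ℝ) * (n : ℝ) ^ (-(γ / 2))) := by field_simp
    _ ≤ _ := mul_le_mul_of_nonneg_right (by linarith) (by positivity)
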